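/- Let $\phi:\mathbb R\to\mathbb R$ be measurable with $\int_{\mathbb R}\phi^2(sz)\,Dz<\infty$ for every $s\in\mathbb R$, where $Dz=\frac1{\sqrt{2\pi}}e^{-z^2/2}dz$, and let $\sigma_\alpha,\sigma_b\in\mathbb R$. Fix a depth $L$, an input dimension $N_0=d\ge 1$ and two inputs $x^{0,1},x^{0,2}\in\mathbb R^{d}$. Consider feedforward networks with widths $N_l$ and ranks $r_l$, $1\le l\le L$, and preactivation vectors $$h^{(l)}=W^{(l)}z^{(l-1)}+\sum_{k=1}^{r_l}b^{(l)}_kC^{(l)}_k,\qquad W^{(l)}=C^{(l)}A^{(l)},\qquad z^{(0)}=x^0,\quad z^{(l)}=\phi(h^{(l)})\text{ (entrywise)},$$ where $C^{(l)}=[C^{(l)}_1,\dots,C^{(l)}_{r_l}]\in\mathbb R^{N_l\times r_l}$ is uniformly distributed (Haar measure) on the matrices with orthonormal columns, $A^{(l)}\in\mathbb R^{r_l\times N_{l-1}}$ has i.i.d. entries $\mathcal N(0,\sigma_\alpha^2/N_{l-1})$, the $b^{(l)}_1,\dots,b^{(l)}_{r_l}$ are i.i.d. $\mathcal N(0,\sigma_b^2)$,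 and all these matrices and vectors are independent. Take the infinite-width limit along any sequence of such networks with $N_l\to\infty$ and $r_l/N_l\to\gamma_l\in(0,1]$ for every $l=1,\dots,L$. Then for $l=1,\dots,L$ and $a,b\in\{1,2\}$ the lengths ($a=b$) and covariances ($a\neq b$) of the preactivations converge in probability to deterministic limits, $$\frac1{N_l}\,h^{(l)}(x^{0,a})^{T}h^{(l)}(x^{0,b})\;\longrightarrow\; q^l_{ab},\qquad q^1_{ab}=\gamma_1\Big(\sigma_\alpha^2\,\tfrac1{d}(x^{0,a})^Tx^{0,b}+\sigma_b^2\Big),$$ and for $2\le l\le L$ these limits satisfy $$q^l_{aa}=\gamma_l\Big(\sigma_\alpha^2\int_{\mathbb R}\phi^2\big(\sqrt{q^{l-1}_{aa}}\,z\big)Dz+\sigma_b^2\Big),\qquad q^l_{12}=\gamma_l\Big(\sigma_\alpha^2\int_{\mathbb R^2}\phi(u_1)\phi(u_2)\,Dz_1Dz_2+\sigma_b^2\Big),$$ with an integrable integrand $\phi(u_1)\phi(u_2)$, where $u_1=\sqrt{q^{l-1}_{11}}\,z_1$, $u_2=\sqrt{q^{l-1}_{22}}\big(c_{12}^{l-1}z_1+\sqrt{1-(c_{12}^{l-1})^2}\,z_2\big)$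 and $c_{12}^{l-1}=q^{l-1}_{12}(q^{l-1}_{11}q^{l-1}_{22})^{-1/2}\in[-1,1]$ (with $c_{12}^{l-1}:=0$ if $q^{l-1}_{11}q^{l-1}_{22}=0$). These are the full-rank maps of Poole et al., $$q\mapsto\sigma_W^2\int\phi^2(\sqrt q\,z)Dz+\sigma^2,\qquad (q_{12},q_{11},q_{22})\mapsto\sigma_W^2\int\!\!\int\phi(u_1)\phi(u_2)\,Dz_1Dz_2+\sigma^2,$$ with weight and bias variances rescaled to $\sigma_W^2=\gamma_l\sigma_\alpha^2$ and $\sigma^2=\gamma_l\sigma_b^2$. -/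

import Mathlib

open MeasureTheory ProbabilityTheory Filter Topology
open scoped Matrix

noncomputable section

/-- The product (equivalently, Borel) sigma-algebra on real matrices. -/
instance instMeasurableSpaceRealMatrix (m n : Type*) : MeasurableSpace (Matrix m n ℝ) :=
  inferInstanceAs (MeasurableSpace (m → n → ℝ))

/-- `ν` is the uniform (Haar) probability law on the `N × r` real matrices with orthonormal columns:
the unique probability measure carried by these matrices that is invariant under
`M ↦ U * M` for every orthogonal `U`. (It exists exactly when `r ≤ N`; its entries have mean zero
and variance `1 / N`, and the column span is a uniformly distributed `r`-dimensional subspace.) -/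
structure IsUniformOrthonormal {N r : ℕ} (ν : Measure (Matrix (Fin N) (Fin r) ℝ)) : Prop where
  isProbabilityMeasure : IsProbabilityMeasure ν
  orthonormal_columns : ∀ᵐ M ∂ν, Mᵀ * M = 1
  orthogonal_invariant : ∀ U ∈ Matrix.orthogonalGroup (Fin N) ℝ, ν.map (fun M => U * M) = ν

/-- Width of layer `l`: the input (layer `0`) has dimension `d`, the layers `l ≥ 1` have
width `N l`. -/
def layerWidth (d : ℕ) (N : ℕ → ℕ) : ℕ → ℕ
  | 0 => d
  | l + 1 => N (l + 1)

/-- The parameters of a low-rank feedforward network with input dimension `d`, widths `N l` and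
ranks `r l` of the layers `l = 1, 2, …`. The fields at index `l` belong to layer `l + 1`:
`C l` has the columns `C_1, …, C_r`, `A l` has the entries `α_{k,j}`, and `b l` holds the
coefficients of the bias along `C_1, …, C_r`. -/
structure LowRankNetwork (d : ℕ) (N r : ℕ → ℕ) where
  C : (l : ℕ) → Matrix (Fin (N (l + 1))) (Fin (r (l + 1))) ℝ
  A : (l : ℕ) → Matrix (Fin (r (l + 1))) (Fin (layerWidth d N l)) ℝ
  b : (l : ℕ) → Fin (r (l + 1)) → ℝ

namespace LowRankNetwork

variable {d : ℕ} {N r : ℕ → ℕ}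

/-- The weight matrix `W = C A` of layer `l + 1`. -/
def weight (θ : LowRankNetwork d N r) (l : ℕ) :
    Matrix (Fin (N (l + 1))) (Fin (layerWidth d N l)) ℝ :=
  θ.C l * θ.A l

/-- The bias vector `∑ₖ bₖ Cₖ` of layer `l + 1`, in the column span of `C`. -/
def bias (θ : LowRankNetwork d N r) (l : ℕ) : Fin (N (l + 1)) → ℝ :=
  θ.C l *ᵥ θ.b l

/-- The output of layer `l`: the input vector `x` for `l = 0`, and `φ` applied entrywise to the
preactivation vector of layer `l` for `l ≥ 1`. -/
def output (φ : ℝ → ℝ) (θ : LowRankNetwork d N r) (x : Fin d → ℝ) :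
    (l : ℕ) → Fin (layerWidth d N l) → ℝ
  | 0 => x
  | l + 1 => fun i => φ ((θ.weight l *ᵥ output φ θ x l + θ.bias l) i)

/-- The preactivation vector `h = W z + bias` of layer `l + 1`, where `z` is the output of
layer `l`. -/
def preactivation (φ : ℝ → ℝ) (θ : LowRankNetwork d N r) (x : Fin d → ℝ) (l : ℕ) :
    Fin (N (l + 1)) → ℝ :=
  θ.weight l *ᵥ θ.output φ x l + θ.bias l

/-- The length (for `x = y`) or covariance `N⁻¹ ∑ᵢ hᵢ(x) hᵢ(y)` of the preactivation vectors of
layer `l + 1`, where `N` is the width of that layer. -/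
def overlap (φ : ℝ → ℝ) (θ : LowRankNetwork d N r) (x y : Fin d → ℝ) (l : ℕ) : ℝ :=
  (∑ i, θ.preactivation φ x l i * θ.preactivation φ y l i) / (N (l + 1) : ℝ)

end LowRankNetwork

/-- The random parameters `θ` of the first `L` layers are drawn at initialization: in each layer,
`C` is uniform on the matrices with orthonormal columns, the entries of `A` are i.i.d.
`𝒩(0, σα² / width of the previous layer)`, the bias coefficients are i.i.d. `𝒩(0, σb²)`,
and `C`, `A`, `b` are mutually independent; different layers are independent. -/
structure IsLowRankInit {Ω : Type*} [MeasurableSpace Ω] (P : Measure Ω) (L : ℕ) (σα σb : ℝ)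
    {d : ℕ} {N r : ℕ → ℕ} (θ : Ω → LowRankNetwork d N r) : Prop where
  measurable_C : ∀ l < L, Measurable fun ω => (θ ω).C l
  measurable_A : ∀ l < L, Measurable fun ω => (θ ω).A l
  measurable_b : ∀ l < L, Measurable fun ω => (θ ω).b l
  law_C : ∀ l < L, IsUniformOrthonormal (P.map fun ω => (θ ω).C l)
  law_A : ∀ l < L, ∀ k j, HasLaw (fun ω => (θ ω).A l k j)
    (gaussianReal 0 (σα ^ 2 / (layerWidth d N l : ℝ)).toNNReal) P
  law_b : ∀ l < L, ∀ k, HasLaw (fun ω => (θ ω).b l k) (gaussianReal 0 (σb ^ 2).toNNReal) P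
  indep_entries_A : ∀ l < L, iIndepFun
    (fun (p : Fin (r (l + 1)) × Fin (layerWidth d N l)) ω => (θ ω).A l p.1 p.2) P
  indep_entries_b : ∀ l < L, iIndepFun (fun (k : Fin (r (l + 1))) ω => (θ ω).b l k) P
  indep_A_b : ∀ l < L, IndepFun (fun ω => (θ ω).A l) (fun ω => (θ ω).b l) P
  indep_C_Ab : ∀ l < L, IndepFun (fun ω => (θ ω).C l) (fun ω => ((θ ω).A l, (θ ω).b l)) P
  indep_layers : iIndepFun
    (fun (l : Fin L) ω => ((θ ω).C l, (θ ω).A l, (θ ω).b l)) P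

/-- The standard Gaussian measure `Dz` on the real line. -/
abbrev stdGaussian1 : Measure ℝ := gaussianReal 0 1

/-- The correlation `c₁₂ = q₁₂ (q₁₁ q₂₂)^(-1/2)`; it is `0` if `q₁₁ q₂₂ = 0`. -/
def corr (q₁₂ q₁₁ q₂₂ : ℝ) : ℝ := q₁₂ / Real.sqrt (q₁₁ * q₂₂)

/-- `u₁ = √q₁₁ z₁`. -/
def gaussU₁ (q₁₁ : ℝ) (z : ℝ × ℝ) : ℝ := Real.sqrt q₁₁ * z.1

/-- `u₂ = √q₂₂ (c z₁ + √(1 - c²) z₂)`. -/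
def gaussU₂ (q₂₂ c : ℝ) (z : ℝ × ℝ) : ℝ :=
  Real.sqrt q₂₂ * (c * z.1 + Real.sqrt (1 - c ^ 2) * z.2)

/-- The full-rank length map of Poole et al., with weight variance `vw` and bias variance `vb`. -/
def pooleLengthMap (φ : ℝ → ℝ) (vw vb q : ℝ) : ℝ :=
  vw * (∫ z, φ (Real.sqrt q * z) ^ 2 ∂stdGaussian1) + vb

/-- The full-rank covariance map of Poole et al., with weight variance `vw` and bias
variance `vb`. -/
def pooleCovMap (φ : ℝ → ℝ) (vw vb q₁₂ q₁₁ q₂₂ : ℝ) : ℝ :=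
  vw * (∫ z, φ (gaussU₁ q₁₁ z) * φ (gaussU₂ q₂₂ (corr q₁₂ q₁₁ q₂₂) z)
    ∂(stdGaussian1.prod stdGaussian1)) + vb

/-- The low-rank length map `γ (σα² ∫ φ²(√q z) Dz + σb²)`. -/
def lengthMap (φ : ℝ → ℝ) (γ σα σb q : ℝ) : ℝ :=
  γ * (σα ^ 2 * (∫ z, φ (Real.sqrt q * z) ^ 2 ∂stdGaussian1) + σb ^ 2)

/-- The low-rank covariance map `γ (σα² ∫∫ φ(u₁) φ(u₂) Dz₁ Dz₂ + σb²)`. -/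
def covMap (φ : ℝ → ℝ) (γ σα σb q₁₂ q₁₁ q₂₂ : ℝ) : ℝ :=
  γ * (σα ^ 2 * (∫ z, φ (gaussU₁ q₁₁ z) * φ (gaussU₂ q₂₂ (corr q₁₂ q₁₁ q₂₂) z)
    ∂(stdGaussian1.prod stdGaussian1)) + σb ^ 2)

end

/-!
Given the input `p = (y, c)` of a layer and its factor `C`, the preactivation `h = C (A y + c b)` is
a centred Gaussian vector with covariance matrix `T C Cᵀ`, where `T` is the variance of an entry of
`A y + c b`, so `E exp (I ξ·h) = E exp (-T |ξ C|² / 2)`. As `h` is linear in `p`, this also covers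
the combinations `s h(p¹) + t h(p²)` for a pair of inputs. Orthogonal invariance makes the law of
`|ξ C|²` that of `|ξ|² |C_i|²` for any row `C_i` of `C`. Taking the mean of `exp (-s |ξ C|²)` also
over a standard Gaussian `ξ`, in both orders, gives the exact identity
`E (1 + 2 s |C_i|²) ^ (-N / 2) = (1 + 2 s) ^ (-r / 2)`, because the columns of `C` are orthonormal.
With `s` replaced by `s / N` it shows that `E exp (-s |C_i|²)` tends to `exp (-γ s)`; with fixed
large `s` it bounds the lower tail of `|C_i|²` exponentially in `N`, hence uniformly over the rows.

The choices `ξ = e_i` and `ξ = e_i - e_j` show that different entries of a layer are asymptotically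
uncorrelated after applying `exp (I ·)`. By the weak law of large numbers the empirical measure of
the pairs of preactivations therefore converges in probability, against trigonometric polynomials,
to a Gaussian pair. To reach products `f(u₁) g(u₂)` with `f`, `g` merely measurable and
square-integrable, note that, off an event of vanishing probability, the row norms lie in `[δ, 1]`,
so the laws of the preactivations are bounded by a fixed multiple of a Gaussian measure `ρ`;
trigonometric polynomials are dense in `L²(ρ)`, and Cauchy-Schwarz controls the error. Applying this
to `φ` and to the identity makes an induction over the layers close. A layer whose limiting input
variance is `0` has no dominating Gaussian density: there one needs the input variance to be exactly
`0` with probability tending to `1`, which is part of the induction hypothesis.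
-/

section ConvergenceInProbability

open scoped RealInnerProductSpace

variable {Ω ι E F : Type*} [MeasurableSpace Ω] {P : Measure Ω} {l : Filter ι}

theorem tendstoInMeasure_const_iff [PseudoMetricSpace E] {u : ι → Ω → E} {c : E} :
    TendstoInMeasure P u l (fun _ => c) ↔
      ∀ s ∈ 𝓝 c, Tendsto (fun i => P {ω | u i ω ∉ s}) l (𝓝 0) := by
  rw [tendstoInMeasure_iff_dist]
  refine ⟨fun h s hs => ?_, fun h ε hε => ?_⟩
  · obtain ⟨ε, hε, hball⟩ := Metric.mem_nhds_iff.1 hs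
    refine tendsto_of_tendsto_of_tendsto_of_le_of_le tendsto_const_nhds (h ε hε)
      (fun _ => zero_le) fun i => measure_mono fun ω hω => ?_
    exact not_lt.1 fun hlt => hω (hball (Metric.mem_ball.2 hlt))
  · simpa [Metric.mem_ball, not_lt] using h _ (Metric.ball_mem_nhds c hε)

theorem tendstoInMeasure_comp_of_tendsto_prod_nhds [PseudoMetricSpace E] [PseudoMetricSpace F]
    {u : ι → Ω → E} {c : E} {Φ : ι → E → F} {d : F}
    (hu : TendstoInMeasure P u l (fun _ => c))
    (hΦ : Tendsto (fun p : ι × E => Φ p.1 p.2) (l ×ˢ 𝓝 c) (𝓝 d)) :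
    TendstoInMeasure P (fun i ω => Φ i (u i ω)) l (fun _ => d) := by
  rw [tendstoInMeasure_const_iff] at hu ⊢
  intro s hs
  obtain ⟨p, hp, t, ht, hpt⟩ := eventually_prod_iff.1 (hΦ hs)
  refine tendsto_of_tendsto_of_tendsto_of_le_of_le' tendsto_const_nhds (hu {x | t x} ht)
    (Eventually.of_forall fun _ => zero_le) ?_
  filter_upwards [hp] with i hi
  exact measure_mono fun ω hω hmem => hω (hpt hi hmem)

theorem tendstoInMeasure_comp_of_continuousAt [PseudoMetricSpace E] [PseudoMetricSpace F]
    {u : ι → Ω → E} {c : E} {Φ : E → F} (hu : TendstoInMeasure P u l (fun _ => c))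
    (hΦ : ContinuousAt Φ c) : TendstoInMeasure P (fun i ω => Φ (u i ω)) l (fun _ => Φ c) :=
  tendstoInMeasure_comp_of_tendsto_prod_nhds hu (hΦ.tendsto.comp tendsto_snd)

theorem tendstoInMeasure_add_const [SeminormedAddCommGroup E] {u v : ι → Ω → E} {c d : E}
    (hu : TendstoInMeasure P u l (fun _ => c)) (hv : TendstoInMeasure P v l (fun _ => d)) :
    TendstoInMeasure P (fun i ω => u i ω + v i ω) l (fun _ => c + d) := by
  rw [tendstoInMeasure_const_iff] at hu hv ⊢
  intro s hs
  obtain ⟨t, ht, t', ht', hsub⟩ := mem_nhds_prod_iff.1 (continuous_add.tendsto (c, d) hs)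
  refine tendsto_of_tendsto_of_tendsto_of_le_of_le tendsto_const_nhds
    (by simpa using (hu t ht).add (hv t' ht')) (fun _ => zero_le) fun i => ?_
  refine (measure_mono fun ω hω => ?_).trans (measure_union_le _ _)
  by_contra hcon
  simp only [Set.mem_union, Set.mem_ofPred_eq, not_or, not_not] at hcon
  exact hω (hsub (Set.mk_mem_prod hcon.1 hcon.2))

theorem tendstoInMeasure_const [PseudoMetricSpace E] (c : E) :
    TendstoInMeasure P (fun (_ : ι) _ => c) l (fun _ => c) :=
  tendstoInMeasure_const_iff.2 fun _ hs => by simp [mem_of_mem_nhds hs, tendsto_const_nhds]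

theorem mem_of_tendstoInMeasure_const [PseudoMetricSpace E] [l.NeBot] [NeZero P] {s : Set E}
    (hs : IsClosed s) {u : ι → Ω → E} {c : E} (hu : TendstoInMeasure P u l (fun _ => c))
    (hmem : ∀ i ω, u i ω ∈ s) : c ∈ s := by
  by_contra hc
  have h := tendstoInMeasure_const_iff.1 hu sᶜ (hs.isOpen_compl.mem_nhds hc)
  simp only [Set.mem_compl_iff, not_not, hmem, Set.ofPred_true] at h
  exact NeZero.ne P (Measure.measure_univ_eq_zero.1 (tendsto_nhds_unique tendsto_const_nhds h))

theorem tendsto_integral_of_tendstoInMeasure_const [NormedAddCommGroup E] [NormedSpace ℝ E]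
    [CompleteSpace E] [IsProbabilityMeasure P] [l.IsCountablyGenerated] {u : ι → Ω → E} {c : E}
    {K : ℝ} (hmeas : ∀ i, AEStronglyMeasurable (u i) P) (hbound : ∀ i ω, ‖u i ω‖ ≤ K)
    (hu : TendstoInMeasure P u l (fun _ => c)) :
    Tendsto (fun i => ∫ ω, u i ω ∂P) l (𝓝 c) := by
  refine tendsto_of_subseq_tendsto fun ns hns => ?_
  obtain ⟨ms, -, hae⟩ := (hu.comp hns).exists_seq_tendsto_ae
  refine ⟨ms, ?_⟩
  simpa using tendsto_integral_of_dominated_convergence (fun _ => K) (fun n => hmeas (ns (ms n)))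
    (integrable_const K) (fun n => .of_forall (hbound (ns (ms n)))) hae

theorem measure_le_edist_le_of_approx [SeminormedAddCommGroup E] {u v : Ω → E} {c d : E}
    {A : Set Ω} (hA : MeasurableSet A) (hm : AEMeasurable (fun ω => ‖u ω - v ω‖ₑ) P)
    {δ : ENNReal} (hδ : δ ≠ 0) (hδtop : δ ≠ ⊤) (hdc : ‖d - c‖ₑ ≤ δ / 3) :
    P {ω | δ ≤ edist (u ω) c} ≤
      P Aᶜ + ((∫⁻ ω in A, ‖u ω - v ω‖ₑ ∂P) / (δ / 3) + P {ω | δ / 3 ≤ edist (v ω) d}) := by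
  have hδ3 : δ / 3 ≠ 0 := (ENNReal.div_pos hδ (by simp)).ne'
  have hδ3' : δ / 3 ≠ ⊤ := ENNReal.div_ne_top hδtop (by simp)
  have hsub : {ω | δ ≤ edist (u ω) c} ⊆
      Aᶜ ∪ ({ω | δ / 3 ≤ ‖u ω - v ω‖ₑ} ∩ A ∪ {ω | δ / 3 ≤ edist (v ω) d}) := by
    intro ω (hω : δ ≤ edist (u ω) c)
    by_contra hcon
    simp only [Set.mem_union, Set.mem_compl_iff, Set.mem_inter_iff, Set.mem_ofPred_eq, not_or,
      not_not, not_and', not_le] at hcon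
    obtain ⟨hAω, huv, hvd⟩ := hcon
    refine hω.not_gt ?_
    calc edist (u ω) c ≤ edist (u ω) (v ω) + edist (v ω) d + edist d c := edist_triangle4 _ _ _ _
      _ < δ / 3 + δ / 3 + δ / 3 := by
          rw [edist_eq_enorm_sub (u ω), edist_eq_enorm_sub d]
          exact ENNReal.add_lt_add_of_lt_of_le (ne_top_of_le_ne_top hδ3' hdc)
            (ENNReal.add_lt_add (huv hAω) hvd) hdc
      _ = δ := ENNReal.add_thirds δ
  have hmarkov : P ({ω | δ / 3 ≤ ‖u ω - v ω‖ₑ} ∩ A) ≤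
      (∫⁻ ω in A, ‖u ω - v ω‖ₑ ∂P) / (δ / 3) := by
    rw [← Measure.restrict_apply' hA]
    exact meas_ge_le_lintegral_div hm.restrict hδ3 hδ3'
  refine (measure_mono hsub).trans <| (measure_union_le _ _).trans ?_
  gcongr
  exact (measure_union_le _ _).trans (by gcongr)

theorem tendstoInMeasure_const_of_approx [SeminormedAddCommGroup E] {u : ι → Ω → E} {c : E}
    {A : ι → Set Ω} (hAm : ∀ i, MeasurableSet (A i)) (hA : Tendsto (fun i => P (A i)ᶜ) l (𝓝 0))
    (happrox : ∀ ε : ENNReal, ε ≠ 0 → ∃ (v : ι → Ω → E) (d : E),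
      (∀ i, AEMeasurable (fun ω => ‖u i ω - v i ω‖ₑ) P) ∧
      TendstoInMeasure P v l (fun _ => d) ∧ ‖d - c‖ₑ ≤ ε ∧
      ∀ᶠ i in l, ∫⁻ ω in A i, ‖u i ω - v i ω‖ₑ ∂P ≤ ε) :
    TendstoInMeasure P u l (fun _ => c) := by
  refine tendstoInMeasure_of_ne_top fun δ hδ hδtop => ENNReal.tendsto_nhds_zero.2 fun η hη => ?_
  have hδ3 : 0 < δ / 3 := ENNReal.div_pos hδ.ne' (by simp)
  have hη3 : 0 < η / 3 := ENNReal.div_pos hη.ne' (by simp)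
  obtain ⟨v, d, hm, hv, hdc, hclose⟩ := happrox (min (δ / 3) (η / 3 * (δ / 3)))
    (lt_min hδ3 (ENNReal.mul_pos hη3.ne' hδ3.ne')).ne'
  filter_upwards [hclose, ENNReal.tendsto_nhds_zero.1 hA _ hη3,
    ENNReal.tendsto_nhds_zero.1 (hv _ hδ3) _ hη3] with i hi hAi hvi
  have hclose' : (∫⁻ ω in A i, ‖u i ω - v i ω‖ₑ ∂P) / (δ / 3) ≤ η / 3 :=
    ENNReal.div_le_of_le_mul (hi.trans (min_le_right _ _))
  calc P {ω | δ ≤ edist (u i ω) c}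
      ≤ P (A i)ᶜ + ((∫⁻ ω in A i, ‖u i ω - v i ω‖ₑ ∂P) / (δ / 3) +
          P {ω | δ / 3 ≤ edist (v i ω) d}) :=
        measure_le_edist_le_of_approx (hAm i) (hm i) hδ.ne' hδtop (hdc.trans (min_le_left _ _))
    _ ≤ η / 3 + (η / 3 + η / 3) := by gcongr
    _ = η := by rw [← add_assoc, ENNReal.add_thirds]

section Average

variable [NormedAddCommGroup E] [InnerProductSpace ℝ E] [IsProbabilityMeasure P]

theorem integrable_inner_of_norm_le {f g : Ω → E} (hf : AEStronglyMeasurable f P)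
    (hg : AEStronglyMeasurable g P) {K : ℝ} (hfK : ∀ ω, ‖f ω‖ ≤ K) (hgK : ∀ ω, ‖g ω‖ ≤ K) :
    Integrable (fun ω => ⟪f ω, g ω⟫) P :=
  .of_bound (hf.inner hg) (K * K) <| .of_forall fun ω => (norm_inner_le_norm _ _).trans <|
    mul_le_mul (hfK ω) (hgK ω) (norm_nonneg _) ((norm_nonneg _).trans (hfK ω))

theorem integral_norm_sq_sum_le {κ : Type*} [Fintype κ] {D : κ → Ω → E}
    (hmeas : ∀ i, AEStronglyMeasurable (D i) P) {K ε : ℝ} (hbound : ∀ i ω, ‖D i ω‖ ≤ K)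
    (hε : 0 ≤ ε) (hcorr : ∀ i j, i ≠ j → ∫ ω, ⟪D i ω, D j ω⟫ ∂P ≤ ε) :
    ∫ ω, ‖∑ i, D i ω‖ ^ 2 ∂P ≤ (Fintype.card κ : ℝ) ^ 2 * ε + Fintype.card κ * K ^ 2 := by
  classical
  have hint : ∀ i j, Integrable (fun ω => ⟪D i ω, D j ω⟫) P := fun i j =>
    integrable_inner_of_norm_le (hmeas i) (hmeas j) (hbound i) (hbound j)
  have hpair : ∀ i j, ∫ ω, ⟪D i ω, D j ω⟫ ∂P ≤ ε + if i = j then K ^ 2 else 0 := by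
    intro i j
    split_ifs with hij
    · subst hij
      refine le_add_of_nonneg_of_le hε ((integral_mono (hint i i)
        (integrable_const (K ^ 2)) fun ω => ?_).trans (by simp))
      simp only [real_inner_self_eq_norm_sq]
      exact pow_le_pow_left₀ (norm_nonneg _) (hbound i ω) 2
    · simpa using hcorr i j hij
  have hexpand : ∀ ω, ‖∑ i, D i ω‖ ^ 2 = ∑ i, ∑ j, ⟪D i ω, D j ω⟫ := fun ω => by
    simp only [← real_inner_self_eq_norm_sq, sum_inner, inner_sum]
    exact Finset.sum_comm
  simp only [hexpand]
  rw [integral_finsetSum _ fun i _ => integrable_finsetSum _ fun j _ => hint i j]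
  simp_rw [integral_finsetSum _ fun j _ => hint _ j]
  refine (Finset.sum_le_sum fun i _ => Finset.sum_le_sum fun j _ => hpair i j).trans_eq ?_
  simp only [Finset.sum_add_distrib, Finset.sum_const, Finset.card_univ, Finset.sum_ite_eq,
    Finset.mem_univ, if_true, nsmul_eq_mul]
  ring

theorem tendstoInMeasure_average_of_integral_inner_le {N : ι → ℕ} (hN : Tendsto N l atTop)
    {D : (n : ι) → Fin (N n) → Ω → E} (hmeas : ∀ n i, AEStronglyMeasurable (D n i) P) {K : ℝ}
    (hbound : ∀ n i ω, ‖D n i ω‖ ≤ K) {ε : ι → ℝ} (hε : Tendsto ε l (𝓝 0))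
    (hcorr : ∀ n i j, i ≠ j → ∫ ω, ⟪D n i ω, D n j ω⟫ ∂P ≤ ε n) :
    TendstoInMeasure P (fun n ω => (N n : ℝ)⁻¹ • ∑ i, D n i ω) l (fun _ => 0) := by
  have hsq : ∀ n, ∫ ω, ‖∑ i, D n i ω‖ ^ 2 ∂P ≤ (N n : ℝ) ^ 2 * |ε n| + N n * K ^ 2 := fun n => by
    simpa using integral_norm_sq_sum_le (hmeas n) (hbound n) (abs_nonneg (ε n))
      fun i j hij => (hcorr n i j hij).trans (le_abs_self _)
  have hsq_int : ∀ n, Integrable (fun ω => ‖∑ i, D n i ω‖ ^ 2) P := fun n => by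
    simp only [← real_inner_self_eq_norm_sq, sum_inner, inner_sum]
    exact integrable_finsetSum _ fun i _ => integrable_finsetSum _ fun j _ =>
      integrable_inner_of_norm_le (hmeas n _) (hmeas n _) (hbound n _) (hbound n _)
  refine tendstoInMeasure_iff_measureReal_norm.2 fun δ hδ => ?_
  have hlim : Tendsto (fun n => (|ε n| + K ^ 2 / N n) / δ ^ 2) l (𝓝 0) := by
    simpa using (hε.abs.add
      (tendsto_const_nhds.div_atTop (tendsto_natCast_atTop_atTop.comp hN))).div_const (δ ^ 2)
  refine tendsto_of_tendsto_of_tendsto_of_le_of_le' tendsto_const_nhds hlim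
    (.of_forall fun _ => measureReal_nonneg) ?_
  filter_upwards [hN.eventually_gt_atTop 0] with n hn
  have hn' : (0 : ℝ) < N n := by exact_mod_cast hn
  have hset : {ω | δ ≤ ‖(N n : ℝ)⁻¹ • ∑ i, D n i ω - 0‖} ⊆
      {ω | (N n * δ) ^ 2 ≤ ‖∑ i, D n i ω‖ ^ 2} := fun ω hω => by
    have hω' : δ ≤ (N n : ℝ)⁻¹ * ‖∑ i, D n i ω‖ := by
      simpa [norm_smul] using hω
    exact pow_le_pow_left₀ (by positivity) ((le_inv_mul_iff₀ hn').1 hω') 2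
  have hchebyshev := mul_meas_ge_le_integral_of_nonneg (.of_forall fun ω => by positivity)
    (hsq_int n) ((N n * δ) ^ 2)
  refine (measureReal_mono hset).trans ?_
  rw [le_div_iff₀ (by positivity), ← mul_le_mul_iff_right₀ (a := (N n : ℝ) ^ 2) (by positivity)]
  calc (N n : ℝ) ^ 2 * (P.real {ω | (N n * δ) ^ 2 ≤ ‖∑ i, D n i ω‖ ^ 2} * δ ^ 2)
      = (N n * δ) ^ 2 * P.real {ω | (N n * δ) ^ 2 ≤ ‖∑ i, D n i ω‖ ^ 2} := by ring
    _ ≤ (N n : ℝ) ^ 2 * |ε n| + N n * K ^ 2 := hchebyshev.trans (hsq n)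
    _ = (N n : ℝ) ^ 2 * (|ε n| + K ^ 2 / N n) := by field_simp

end Average

end ConvergenceInProbability

section Matrices

instance instBorelSpaceRealMatrix (m n : Type*) [Countable m] [Countable n] :
    BorelSpace (Matrix m n ℝ) :=
  inferInstanceAs (BorelSpace (m → n → ℝ))

instance instSecondCountableTopologyRealMatrix (m n : Type*) [Countable m] [Countable n] :
    SecondCountableTopology (Matrix m n ℝ) :=
  inferInstanceAs (SecondCountableTopology (m → n → ℝ))

theorem dotProduct_self_nonneg {n : Type*} [Fintype n] (v : n → ℝ) : 0 ≤ v ⬝ᵥ v := by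
  simpa using dotProduct_star_self_nonneg v

variable {N r : ℕ}

/-- The squared Euclidean norm of the `i`-th row of a matrix. -/
def rowNormSq (M : Matrix (Fin N) (Fin r) ℝ) (i : Fin N) : ℝ := M i ⬝ᵥ M i

theorem rowNormSq_nonneg (M : Matrix (Fin N) (Fin r) ℝ) (i : Fin N) : 0 ≤ rowNormSq M i :=
  dotProduct_self_nonneg (M i)

@[fun_prop]
theorem continuous_rowNormSq (i : Fin N) :
    Continuous fun M : Matrix (Fin N) (Fin r) ℝ => rowNormSq M i := by
  unfold rowNormSq
  fun_prop

theorem vecMul_dotProduct_self_single (M : Matrix (Fin N) (Fin r) ℝ) (i : Fin N) (t : ℝ) :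
    (Pi.single i t ᵥ* M) ⬝ᵥ (Pi.single i t ᵥ* M) = t ^ 2 * rowNormSq M i := by
  rw [Matrix.single_vecMul, smul_dotProduct, dotProduct_smul, smul_smul, sq, smul_eq_mul]
  rfl

theorem rowNormSq_le_one {M : Matrix (Fin N) (Fin r) ℝ} (hM : Mᵀ * M = 1) (i : Fin N) :
    rowNormSq M i ≤ 1 := by
  have hidem : M * Mᵀ * (M * Mᵀ)ᵀ = M * Mᵀ := by
    rw [Matrix.transpose_mul, Matrix.transpose_transpose, Matrix.mul_assoc, ← Matrix.mul_assoc Mᵀ,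
      hM, Matrix.one_mul]
  have hdiag : rowNormSq M i = ∑ j, (M * Mᵀ) i j ^ 2 := by
    refine (congrFun (congrFun hidem i) i).symm.trans ?_
    simp only [Matrix.mul_apply (M := M * Mᵀ), Matrix.transpose_apply, sq]
  have hle : rowNormSq M i ^ 2 ≤ rowNormSq M i := by
    conv_rhs => rw [hdiag]
    exact Finset.single_le_sum (f := fun j => (M * Mᵀ) i j ^ 2) (fun j _ => sq_nonneg _)
      (Finset.mem_univ i)
  nlinarith [rowNormSq_nonneg M i]

theorem mulVec_dotProduct_mulVec_self {M : Matrix (Fin N) (Fin r) ℝ} (hM : Mᵀ * M = 1)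
    (w : Fin r → ℝ) : (M *ᵥ w) ⬝ᵥ (M *ᵥ w) = w ⬝ᵥ w := by
  rw [Matrix.dotProduct_mulVec, ← Matrix.mulVec_transpose, Matrix.mulVec_mulVec, hM,
    Matrix.one_mulVec]

theorem exists_orthogonal_vecMul_eq {v w : Fin N → ℝ} (hvw : v ⬝ᵥ v = w ⬝ᵥ w) :
    ∃ U ∈ Matrix.orthogonalGroup (Fin N) ℝ, v ᵥ* U = w := by
  set n : Fin N → ℝ := v - w with hn
  have hnn : n ⬝ᵥ n = 2 * (v ⬝ᵥ n) := by
    simp only [hn, sub_dotProduct, dotProduct_sub, dotProduct_comm w v, hvw]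
    ring
  by_cases h0 : n ⬝ᵥ n = 0
  · have hvw' : v = w := sub_eq_zero.1 (dotProduct_self_eq_zero.1 h0)
    exact ⟨1, one_mem _, by rw [Matrix.vecMul_one, hvw']⟩
  obtain ⟨c, hcn⟩ : ∃ c : ℝ, c * (n ⬝ᵥ n) = 2 := ⟨2 / (n ⬝ᵥ n), div_mul_cancel₀ 2 h0⟩
  refine ⟨1 - c • Matrix.vecMulVec n n, ?_, ?_⟩
  · rw [Matrix.mem_orthogonalGroup_iff, Matrix.transpose_sub, Matrix.transpose_one,
      Matrix.transpose_smul, Matrix.transpose_vecMulVec, sub_mul, mul_sub, mul_sub, one_mul,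
      mul_one, one_mul, Matrix.smul_mul, Matrix.mul_smul, Matrix.vecMulVec_mul_vecMulVec,
      Matrix.vecMulVec_smul, smul_smul, smul_smul, mul_assoc, hcn, mul_two, add_smul]
    abel
  · have hcv : c * (v ⬝ᵥ n) = 1 := by rw [hnn] at hcn; linarith
    rw [Matrix.vecMul_sub, Matrix.vecMul_one, Matrix.vecMul_smul, Matrix.vecMul_vecMulVec,
      smul_smul, hcv, one_smul, hn, sub_sub_cancel]

end Matrices

section GaussianLaplace

theorem integral_exp_neg_mul_sq_stdGaussian1 {s : ℝ} (hs : 0 ≤ s) :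
    ∫ x, Real.exp (-(s * x ^ 2)) ∂stdGaussian1 = (1 + 2 * s) ^ (-(1 / 2) : ℝ) := by
  have hpdf : ∀ x, gaussianPDFReal 0 1 x • Real.exp (-(s * x ^ 2)) =
      (√(2 * Real.pi))⁻¹ * Real.exp (-(s + 1 / 2) * x ^ 2) := fun x => by
    simp only [gaussianPDFReal, sub_zero, NNReal.coe_one, mul_one, smul_eq_mul, mul_assoc,
      ← Real.exp_add]
    ring_nf
  rw [integral_gaussianReal_eq_integral_smul one_ne_zero]
  simp_rw [hpdf]
  rw [integral_const_mul, integral_gaussian, Real.rpow_neg (by positivity), ← Real.sqrt_eq_rpow,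
    ← Real.sqrt_inv, ← Real.sqrt_mul (by positivity), ← Real.sqrt_inv]
  congr 1
  field_simp
  ring

theorem integral_exp_neg_mul_dotProduct_self (r : ℕ) {s : ℝ} (hs : 0 ≤ s) :
    ∫ w, Real.exp (-(s * (w ⬝ᵥ w))) ∂(Measure.pi fun _ : Fin r => stdGaussian1) =
      (1 + 2 * s) ^ (-(r / 2) : ℝ) := by
  have h := integral_fintype_prod_eq_pow (ι := Fin r) (μ := stdGaussian1)
    fun x : ℝ => Real.exp (-(s * x ^ 2))
  rw [Fintype.card_fin, integral_exp_neg_mul_sq_stdGaussian1 hs, ← Real.rpow_natCast,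
    ← Real.rpow_mul (by positivity)] at h
  rw [show -(r / 2 : ℝ) = -(1 / 2) * r by ring, ← h]
  simp only [← Real.exp_sum, Finset.sum_neg_distrib, ← Finset.mul_sum, dotProduct, sq]

theorem charFun_map_toLp {n : ℕ} (ν : Measure (Fin n → ℝ)) (t : EuclideanSpace ℝ (Fin n)) :
    charFun (ν.map (WithLp.toLp 2)) t =
      ∫ ξ, Complex.exp ((ξ ⬝ᵥ t.ofLp : ℝ) * Complex.I) ∂ν := by
  rw [charFun_apply, integral_map (by fun_prop) (by fun_prop)]
  simp [PiLp.inner_apply, dotProduct, mul_comm]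

theorem integral_cexp_dotProduct_stdGaussian {n : ℕ} (w : Fin n → ℝ) :
    ∫ ξ, Complex.exp ((ξ ⬝ᵥ w : ℝ) * Complex.I) ∂(Measure.pi fun _ : Fin n => stdGaussian1) =
      Complex.exp (-(w ⬝ᵥ w : ℝ) / 2) := by
  refine (charFun_map_toLp _ (WithLp.toLp 2 w)).symm.trans ?_
  rw [charFun_pi]
  simp only [charFun_gaussianReal, ← Complex.exp_sum]
  simp [dotProduct, ← Finset.sum_div, sq, neg_div]

variable {N r : ℕ}

theorem map_vecMul_stdGaussian {M : Matrix (Fin N) (Fin r) ℝ} (hM : Mᵀ * M = 1) :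
    (Measure.pi fun _ : Fin N => stdGaussian1).map (fun ξ => ξ ᵥ* M) =
      Measure.pi fun _ : Fin r => stdGaussian1 := by
  refine charFun_eq_pi_iff.1 fun t => ?_
  rw [charFun_map_toLp, integral_map (Continuous.aemeasurable (by fun_prop)) (by fun_prop),
    ← charFun_pi, charFun_map_toLp]
  simp_rw [← Matrix.dotProduct_mulVec]
  rw [integral_cexp_dotProduct_stdGaussian, integral_cexp_dotProduct_stdGaussian,
    mulVec_dotProduct_mulVec_self hM]

theorem integral_exp_neg_mul_vecMul_dotProduct_self {M : Matrix (Fin N) (Fin r) ℝ}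
    (hM : Mᵀ * M = 1) {s : ℝ} (hs : 0 ≤ s) :
    ∫ ξ, Real.exp (-(s * ((ξ ᵥ* M) ⬝ᵥ (ξ ᵥ* M)))) ∂(Measure.pi fun _ : Fin N => stdGaussian1) =
      (1 + 2 * s) ^ (-(r / 2) : ℝ) := by
  rw [← integral_exp_neg_mul_dotProduct_self r hs, ← map_vecMul_stdGaussian hM,
    integral_map (Continuous.aemeasurable (by fun_prop))
      (Continuous.aestronglyMeasurable (by fun_prop))]

end GaussianLaplace

theorem sub_sq_half_le_log_one_add {x : ℝ} (hx : 0 ≤ x) : x - x ^ 2 / 2 ≤ Real.log (1 + x) := by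
  refine le_trans ?_ (Real.le_log_one_add_of_nonneg hx)
  rw [le_div_iff₀ (by positivity)]
  nlinarith [pow_nonneg hx 3]

namespace IsUniformOrthonormal

variable {N r : ℕ} {ν : Measure (Matrix (Fin N) (Fin r) ℝ)}

theorem map_vecMul_dotProduct_self (hν : IsUniformOrthonormal ν) (ξ : Fin N → ℝ) (i : Fin N) :
    ν.map (fun M => (ξ ᵥ* M) ⬝ᵥ (ξ ᵥ* M)) = ν.map fun M => (ξ ⬝ᵥ ξ) * rowNormSq M i := by
  have hsq : √(ξ ⬝ᵥ ξ) ^ 2 = ξ ⬝ᵥ ξ :=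
    Real.sq_sqrt (dotProduct_self_nonneg ξ)
  obtain ⟨U, hU, hUξ⟩ := exists_orthogonal_vecMul_eq (v := ξ) (w := Pi.single i √(ξ ⬝ᵥ ξ))
    (by simp [← sq, hsq])
  conv_lhs =>
    rw [← hν.orthogonal_invariant U hU, Measure.map_map (Continuous.measurable (by fun_prop))
      (Continuous.measurable (by fun_prop))]
  simp only [Function.comp_def, ← Matrix.vecMul_vecMul, hUξ, vecMul_dotProduct_self_single, hsq]

theorem integral_one_add_rowNormSq_rpow (hν : IsUniformOrthonormal ν) {s : ℝ} (hs : 0 ≤ s)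
    (i : Fin N) :
    ∫ M, (1 + 2 * (s * rowNormSq M i)) ^ (-(N / 2) : ℝ) ∂ν = (1 + 2 * s) ^ (-(r / 2) : ℝ) := by
  have := hν.isProbabilityMeasure
  set G : Measure (Fin N → ℝ) := Measure.pi fun _ => stdGaussian1
  have hint : ∀ f : (Fin N → ℝ) → Matrix (Fin N) (Fin r) ℝ → ℝ, Continuous (Function.uncurry f) →
      (∀ ξ M, 0 ≤ f ξ M) → Integrable (fun p => Real.exp (-(s * f p.1 p.2))) (G.prod ν) := by
    intro f hf hf0
    refine .of_bound (Continuous.aestronglyMeasurable ?_) 1 (.of_forall fun p => ?_)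
    · exact Real.continuous_exp.comp (continuous_const.mul hf).neg
    · simpa [Real.abs_exp] using mul_nonneg hs (hf0 p.1 p.2)
  calc ∫ M, (1 + 2 * (s * rowNormSq M i)) ^ (-(N / 2) : ℝ) ∂ν
      = ∫ M, ∫ ξ, Real.exp (-(s * ((ξ ⬝ᵥ ξ) * rowNormSq M i))) ∂G ∂ν := by
        simp_rw [← integral_exp_neg_mul_dotProduct_self N (mul_nonneg hs (rowNormSq_nonneg _ i)),
          mul_assoc, mul_comm]
        rfl
    _ = ∫ ξ, ∫ M, Real.exp (-(s * ((ξ ⬝ᵥ ξ) * rowNormSq M i))) ∂ν ∂G :=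
        (integral_integral_swap (hint (fun ξ M => (ξ ⬝ᵥ ξ) * rowNormSq M i)
          (by unfold Function.uncurry; fun_prop)
          fun ξ M => mul_nonneg (dotProduct_self_nonneg ξ) (rowNormSq_nonneg M i))).symm
    _ = ∫ ξ, ∫ M, Real.exp (-(s * ((ξ ᵥ* M) ⬝ᵥ (ξ ᵥ* M)))) ∂ν ∂G := by
        refine integral_congr_ae (.of_forall fun ξ => ?_)
        simp only
        rw [← integral_map (f := fun x => Real.exp (-(s * x)))
          (Continuous.aemeasurable (by fun_prop)) (by fun_prop),
          ← hν.map_vecMul_dotProduct_self ξ i, integral_map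
          (Continuous.aemeasurable (by fun_prop)) (by fun_prop)]
    _ = ∫ M, ∫ ξ, Real.exp (-(s * ((ξ ᵥ* M) ⬝ᵥ (ξ ᵥ* M)))) ∂G ∂ν :=
        integral_integral_swap (hint (fun ξ M => (ξ ᵥ* M) ⬝ᵥ (ξ ᵥ* M))
          (by unfold Function.uncurry; fun_prop)
          fun ξ M => dotProduct_self_nonneg (ξ ᵥ* M))
    _ = ∫ _, (1 + 2 * s) ^ (-(r / 2) : ℝ) ∂ν := by
        refine integral_congr_ae ?_
        filter_upwards [hν.orthonormal_columns] with M hM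
        exact integral_exp_neg_mul_vecMul_dotProduct_self hM hs
    _ = (1 + 2 * s) ^ (-(r / 2) : ℝ) := by simp

theorem integrable_exp_neg_rowNormSq (hν : IsUniformOrthonormal ν) {s : ℝ} (hs : 0 ≤ s)
    (i : Fin N) : Integrable (fun M => Real.exp (-(s * rowNormSq M i))) ν := by
  have := hν.isProbabilityMeasure
  refine .of_bound (Continuous.aestronglyMeasurable (by fun_prop)) 1 (.of_forall fun M => ?_)
  simpa [Real.abs_exp] using mul_nonneg hs (rowNormSq_nonneg M i)

theorem integrable_one_add_rowNormSq_rpow (hν : IsUniformOrthonormal ν) {s : ℝ} (hs : 0 ≤ s)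
    (i : Fin N) :
    Integrable (fun M => (1 + 2 * (s * rowNormSq M i)) ^ (-(N / 2) : ℝ)) ν := by
  have := hν.isProbabilityMeasure
  have hbase : ∀ M : Matrix (Fin N) (Fin r) ℝ, 1 ≤ 1 + 2 * (s * rowNormSq M i) := fun M => by
    have := mul_nonneg hs (rowNormSq_nonneg M i)
    linarith
  refine .of_bound (Continuous.aestronglyMeasurable ?_) 1 (.of_forall fun M => ?_)
  · exact Continuous.rpow_const (by fun_prop) fun M => .inl (by linarith [hbase M])
  · rw [Real.norm_of_nonneg (Real.rpow_nonneg (by linarith [hbase M]) _)]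
    exact Real.rpow_le_one_of_one_le_of_nonpos (hbase M) (neg_nonpos.2 (by positivity))

theorem measureReal_rowNormSq_le (hν : IsUniformOrthonormal ν) {s δ : ℝ} (hs : 0 ≤ s)
    (hδ : 0 ≤ δ) (i : Fin N) :
    ν.real {M | rowNormSq M i ≤ δ} ≤
      (1 + 2 * (s * δ)) ^ (N / 2 : ℝ) * (1 + 2 * s) ^ (-(r / 2) : ℝ) := by
  have := hν.isProbabilityMeasure
  have hδpos : 0 < 1 + 2 * (s * δ) := by positivity
  have hpos : ∀ M : Matrix (Fin N) (Fin r) ℝ, 0 < 1 + 2 * (s * rowNormSq M i) := fun M => by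
    have := mul_nonneg hs (rowNormSq_nonneg M i)
    linarith
  have hmarkov := mul_meas_ge_le_integral_of_nonneg
    (.of_forall fun M => Real.rpow_nonneg (hpos M).le _)
    (hν.integrable_one_add_rowNormSq_rpow hs i) ((1 + 2 * (s * δ)) ^ (-(N / 2) : ℝ))
  rw [hν.integral_one_add_rowNormSq_rpow hs i, Real.rpow_neg hδpos.le,
    inv_mul_le_iff₀ (by positivity)] at hmarkov
  refine (measureReal_mono fun M (hM : rowNormSq M i ≤ δ) => ?_).trans hmarkov
  rw [Set.mem_ofPred_eq, ← Real.rpow_neg hδpos.le]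
  refine Real.rpow_le_rpow_of_nonpos (hpos M) ?_ (neg_nonpos.2 (by positivity))
  gcongr

theorem integral_exp_neg_rowNormSq_le (hν : IsUniformOrthonormal ν) {s : ℝ} (hs : 0 ≤ s)
    (i : Fin N) :
    ∫ M, Real.exp (-(s * rowNormSq M i)) ∂ν ≤ (1 + 2 * (s / N)) ^ (-(r / 2) : ℝ) := by
  have hN : (0 : ℝ) < N := by exact_mod_cast i.pos
  have hsN : 0 ≤ s / N := by positivity
  rw [← hν.integral_one_add_rowNormSq_rpow hsN i]
  refine integral_mono (hν.integrable_exp_neg_rowNormSq hs i)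
    (hν.integrable_one_add_rowNormSq_rpow hsN i) fun M => ?_
  have hβ := rowNormSq_nonneg M i
  simp only
  rw [Real.rpow_def_of_pos (by positivity), Real.exp_le_exp, mul_neg, neg_le_neg_iff]
  have hlog := Real.log_le_sub_one_of_pos (x := 1 + 2 * (s / N * rowNormSq M i)) (by positivity)
  calc Real.log (1 + 2 * (s / N * rowNormSq M i)) * (N / 2)
      ≤ (2 * (s / N * rowNormSq M i)) * (N / 2) := by gcongr; linarith
    _ = s * rowNormSq M i := by field_simp

theorem le_integral_exp_neg_rowNormSq (hν : IsUniformOrthonormal ν) {s : ℝ} (hs : 0 ≤ s)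
    (i : Fin N) :
    Real.exp (-(s ^ 2 / N)) * (1 + 2 * (s / N)) ^ (-(r / 2) : ℝ) ≤
      ∫ M, Real.exp (-(s * rowNormSq M i)) ∂ν := by
  have hN : (0 : ℝ) < N := by exact_mod_cast i.pos
  have hsN : 0 ≤ s / N := by positivity
  rw [← hν.integral_one_add_rowNormSq_rpow hsN i, ← integral_const_mul]
  refine integral_mono_ae ((hν.integrable_one_add_rowNormSq_rpow hsN i).const_mul _)
    (hν.integrable_exp_neg_rowNormSq hs i) ?_
  filter_upwards [hν.orthonormal_columns] with M hM
  have hβ := rowNormSq_nonneg M i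
  set x : ℝ := 2 * (s / N * rowNormSq M i) with hx
  have hx0 : 0 ≤ x := by positivity
  have hx1 : x ^ 2 * (N / 4) ≤ s ^ 2 / N := by
    have : rowNormSq M i ^ 2 ≤ 1 := pow_le_one₀ hβ (rowNormSq_le_one hM i)
    calc x ^ 2 * (N / 4) = s ^ 2 / N * rowNormSq M i ^ 2 := by rw [hx]; field_simp; ring
      _ ≤ s ^ 2 / N := mul_le_of_le_one_right (by positivity) this
  rw [Real.rpow_def_of_pos (by positivity), ← Real.exp_add, Real.exp_le_exp]
  have hsx : s * rowNormSq M i = x * (N / 2) := by rw [hx]; field_simp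
  have hN2 : (0 : ℝ) ≤ N / 2 := by positivity
  nlinarith [mul_le_mul_of_nonneg_right (sub_sq_half_le_log_one_add hx0) hN2]

end IsUniformOrthonormal

section RowLaplace

variable {N r : ℕ} {ν : Measure (Matrix (Fin N) (Fin r) ℝ)}

/-- The Laplace transform of the squared norm of a row of a random matrix with law `ν`, averaged
over the rows. For `IsUniformOrthonormal ν` all rows have the same law; averaging avoids singling
out one of them. -/
noncomputable def rowLaplace (ν : Measure (Matrix (Fin N) (Fin r) ℝ)) (s : ℝ) : ℝ :=
  (N : ℝ)⁻¹ * ∑ i, ∫ M, Real.exp (-(s * rowNormSq M i)) ∂ν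

theorem measurable_rowLaplace [SFinite ν] : Measurable (rowLaplace ν) := by
  refine (Finset.measurable_fun_sum _ fun i _ => ?_).const_mul _
  exact (StronglyMeasurable.integral_prod_right (f := fun s M => Real.exp (-(s * rowNormSq M i)))
    (Continuous.stronglyMeasurable (by unfold Function.uncurry; fun_prop))).measurable

namespace IsUniformOrthonormal

theorem integral_exp_neg_vecMul (hν : IsUniformOrthonormal ν) (hN : N ≠ 0) (s : ℝ)
    (ξ : Fin N → ℝ) :
    ∫ M, Real.exp (-(s * ((ξ ᵥ* M) ⬝ᵥ (ξ ᵥ* M)))) ∂ν = rowLaplace ν (s * (ξ ⬝ᵥ ξ)) := by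
  have hrow : ∀ i, ∫ M, Real.exp (-(s * (ξ ⬝ᵥ ξ) * rowNormSq M i)) ∂ν =
      ∫ M, Real.exp (-(s * ((ξ ᵥ* M) ⬝ᵥ (ξ ᵥ* M)))) ∂ν := fun i => by
    rw [← integral_map (f := fun x => Real.exp (-(s * x)))
      (Continuous.aemeasurable (by fun_prop)) (by fun_prop), hν.map_vecMul_dotProduct_self ξ i,
      integral_map (Continuous.aemeasurable (by fun_prop)) (by fun_prop)]
    simp only [mul_assoc]
  have hN' : (N : ℝ) ≠ 0 := by exact_mod_cast hN
  simp only [rowLaplace, hrow, Finset.sum_const, Finset.card_univ, Fintype.card_fin, nsmul_eq_mul,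
    inv_mul_cancel_left₀ hN']

theorem rowLaplace_eq_integral (hν : IsUniformOrthonormal ν) (s : ℝ) (i : Fin N) :
    rowLaplace ν s = ∫ M, Real.exp (-(s * rowNormSq M i)) ∂ν := by
  have h := hν.integral_exp_neg_vecMul i.pos.ne' s (Pi.single i 1)
  simp only [vecMul_dotProduct_self_single, one_pow, one_mul, dotProduct_single_one,
    Pi.single_eq_same, mul_one] at h
  exact h.symm

end IsUniformOrthonormal

end RowLaplace

section Asymptotics

variable {κ : Type*} {k : Filter κ} {N r : κ → ℕ} {γ : ℝ}

theorem tendsto_one_add_two_mul_div_rpow (hN : Tendsto N k atTop)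
    (hr : Tendsto (fun x => (r x : ℝ) / N x) k (𝓝 γ)) {s : κ → ℝ} {s₀ : ℝ} (hs0 : ∀ x, 0 ≤ s x)
    (hs : Tendsto s k (𝓝 s₀)) :
    Tendsto (fun x => (1 + 2 * (s x / N x)) ^ (-(r x / 2) : ℝ)) k
      (𝓝 (Real.exp (-(γ * s₀)))) := by
  have hpos : ∀ x, 0 < 1 + 2 * (s x / N x) := fun x => by
    have := hs0 x
    positivity
  have hNinv : Tendsto (fun x => (N x : ℝ)⁻¹) k (𝓝 0) :=
    tendsto_inv_atTop_zero.comp (tendsto_natCast_atTop_atTop.comp hN)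
  have hupper : Tendsto (fun x => (r x : ℝ) / N x * s x) k (𝓝 (γ * s₀)) := hr.mul hs
  have hlower : Tendsto (fun x => (r x : ℝ) / N x * s x - r x / N x * s x ^ 2 * (N x : ℝ)⁻¹) k
      (𝓝 (γ * s₀)) := by
    simpa using hupper.sub ((hr.mul (hs.pow 2)).mul hNinv)
  have hlog : Tendsto (fun x => Real.log (1 + 2 * (s x / N x)) * (r x / 2)) k (𝓝 (γ * s₀)) := by
    refine tendsto_of_tendsto_of_tendsto_of_le_of_le hlower hupper (fun x => ?_) fun x => ?_
    · have h := sub_sq_half_le_log_one_add (x := 2 * (s x / N x))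
        (by have := hs0 x; positivity)
      refine le_trans (le_of_eq ?_) (mul_le_mul_of_nonneg_right h (by positivity))
      ring
    · have h := Real.log_le_sub_one_of_pos (hpos x)
      refine (mul_le_mul_of_nonneg_right h (by positivity)).trans_eq ?_
      ring
  refine (Real.continuous_exp.tendsto _ |>.comp hlog.neg).congr fun x => ?_
  rw [Function.comp_apply, Real.rpow_def_of_pos (hpos x), mul_neg]

variable {ν : (x : κ) → Measure (Matrix (Fin (N x)) (Fin (r x)) ℝ)}

theorem tendsto_rowLaplace (hν : ∀ x, IsUniformOrthonormal (ν x)) (hN : Tendsto N k atTop)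
    (hr : Tendsto (fun x => (r x : ℝ) / N x) k (𝓝 γ)) {s : κ → ℝ} {s₀ : ℝ} (hs0 : ∀ x, 0 ≤ s x)
    (hs : Tendsto s k (𝓝 s₀)) :
    Tendsto (fun x => rowLaplace (ν x) (s x)) k (𝓝 (Real.exp (-(γ * s₀)))) := by
  have hupper := tendsto_one_add_two_mul_div_rpow hN hr hs0 hs
  have herr : Tendsto (fun x => Real.exp (-(s x ^ 2 / N x))) k (𝓝 1) := by
    have h := ((hs.pow 2).div_atTop (tendsto_natCast_atTop_atTop.comp hN)).neg
    simpa [Function.comp_def] using (Real.continuous_exp.tendsto _).comp h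
  have hlower := herr.mul hupper
  rw [one_mul] at hlower
  refine tendsto_of_tendsto_of_tendsto_of_le_of_le' hlower hupper ?_ ?_
  all_goals filter_upwards [hN.eventually_gt_atTop 0] with x hx
  all_goals rw [(hν x).rowLaplace_eq_integral (s x) ⟨0, hx⟩]
  · exact (hν x).le_integral_exp_neg_rowNormSq (hs0 x) _
  · exact (hν x).integral_exp_neg_rowNormSq_le (hs0 x) _

theorem exists_forall_measureReal_rowNormSq_le (hν : ∀ x, IsUniformOrthonormal (ν x))
    (hγ : 0 < γ) (hr : Tendsto (fun x => (r x : ℝ) / N x) k (𝓝 γ)) :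
    ∃ δ > 0, ∀ᶠ x in k, ∀ i, (ν x).real {M | rowNormSq M i ≤ δ} ≤ (1 / 2) ^ N x := by
  have hbase : (1 : ℝ) < 2 ^ (6 / γ) := Real.one_lt_rpow (by norm_num) (by positivity)
  have hδ : (0 : ℝ) < 2 ^ (6 / γ) - 1 := sub_pos.2 hbase
  refine ⟨(2 ^ (6 / γ) - 1)⁻¹, inv_pos.2 hδ, ?_⟩
  filter_upwards [hr.eventually_const_lt (half_lt_self hγ)] with x hx i
  have hNx : (0 : ℝ) < N x := by exact_mod_cast i.pos
  refine ((hν x).measureReal_rowNormSq_le (s := (2 ^ (6 / γ) - 1) / 2) (by positivity)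
    (inv_pos.2 hδ).le i).trans ?_
  have hleft : 1 + 2 * ((2 ^ (6 / γ) - 1) / 2 * ((2 : ℝ) ^ (6 / γ) - 1)⁻¹) = 2 := by
    field_simp
    norm_num
  have hright : 1 + 2 * (((2 : ℝ) ^ (6 / γ) - 1) / 2) = 2 ^ (6 / γ) := by ring
  rw [hleft, hright, ← Real.rpow_mul zero_le_two, ← Real.rpow_add two_pos, one_div, inv_pow,
    ← Real.rpow_natCast, ← Real.rpow_neg zero_le_two]
  refine Real.rpow_le_rpow_of_exponent_le one_le_two ?_
  have hrx : γ / 2 * N x < r x := (lt_div_iff₀ hNx).1 hx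
  have : 6 / γ * (γ / 2 * N x) ≤ 6 / γ * r x := by gcongr
  have h3 : 6 / γ * (γ / 2 * N x) = 3 * N x := by field_simp; norm_num
  linarith

theorem exists_tendsto_measure_rowNormSq_le (hν : ∀ x, IsUniformOrthonormal (ν x))
    (hγ : 0 < γ) (hN : Tendsto N k atTop) (hr : Tendsto (fun x => (r x : ℝ) / N x) k (𝓝 γ)) :
    ∃ δ > 0, Tendsto (fun x => ν x {M | ∃ i, rowNormSq M i ≤ δ}) k (𝓝 0) := by
  obtain ⟨δ, hδ, hle⟩ := exists_forall_measureReal_rowNormSq_le hν hγ hr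
  refine ⟨δ, hδ, ?_⟩
  have hlim : Tendsto (fun x => ENNReal.ofReal (N x * (1 / 2) ^ N x)) k (𝓝 0) := by
    have h := (tendsto_self_mul_const_pow_of_lt_one (r := (1 / 2 : ℝ)) (by norm_num)
      (by norm_num)).comp hN
    simpa using ENNReal.tendsto_ofReal h
  refine tendsto_of_tendsto_of_tendsto_of_le_of_le' tendsto_const_nhds hlim
    (.of_forall fun _ => zero_le) ?_
  filter_upwards [hle] with x hx
  have := (hν x).isProbabilityMeasure
  rw [← ofReal_measureReal]
  refine ENNReal.ofReal_le_ofReal ?_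
  calc (ν x).real {M | ∃ i, rowNormSq M i ≤ δ}
      ≤ ∑ i, (ν x).real {M | rowNormSq M i ≤ δ} := by
        rw [Set.ofPred_exists]
        exact measureReal_iUnion_fintype_le _
    _ ≤ N x * (1 / 2) ^ N x := by
        simpa using Finset.sum_le_sum fun i (_ : i ∈ Finset.univ) => hx i

end Asymptotics

section Independence

variable {Ω 𝒳 𝒴 𝒵 : Type*} [MeasurableSpace Ω] [MeasurableSpace 𝒳] [MeasurableSpace 𝒴]
  [MeasurableSpace 𝒵] {P : Measure Ω} [IsProbabilityMeasure P] {X : Ω → 𝒳} {Y : Ω → 𝒴} {Z : Ω → 𝒵}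

theorem indepFun_prodMk_left_of_prodMk_right (hX : Measurable X) (hY : Measurable Y)
    (hZ : Measurable Z) (h : IndepFun X (fun ω => (Y ω, Z ω)) P) (h' : IndepFun Y Z P) :
    IndepFun (fun ω => (X ω, Y ω)) Z P := by
  have := Measure.isProbabilityMeasure_map (μ := P) hX.aemeasurable
  have := Measure.isProbabilityMeasure_map (μ := P) hY.aemeasurable
  have := Measure.isProbabilityMeasure_map (μ := P) hZ.aemeasurable
  have hXY : IndepFun X Y P := h.comp measurable_id measurable_fst
  have hlaw := (indepFun_iff_map_prod_eq_prod_map_map hX.aemeasurable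
    (hY.prodMk hZ).aemeasurable).1 h
  have hlaw' := (indepFun_iff_map_prod_eq_prod_map_map hY.aemeasurable hZ.aemeasurable).1 h'
  have hlawXY := (indepFun_iff_map_prod_eq_prod_map_map hX.aemeasurable hY.aemeasurable).1 hXY
  refine (indepFun_iff_map_prod_eq_prod_map_map (hX.prodMk hY).aemeasurable
    hZ.aemeasurable).2 ?_
  have hassoc := (measurePreserving_prodAssoc (P.map X) (P.map Y) (P.map Z)).symm.map_eq
  rw [hlawXY, ← hassoc, ← hlaw', ← hlaw, Measure.map_map (MeasurableEquiv.measurable _)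
    (hX.prodMk (hY.prodMk hZ))]
  rfl

theorem integral_comp_prodMk_of_indepFun {E : Type*} [NormedAddCommGroup E] [NormedSpace ℝ E]
    (hX : Measurable X) (hY : Measurable Y) (h : IndepFun X Y P) {f : 𝒳 → 𝒴 → E}
    (hf : StronglyMeasurable (Function.uncurry f)) {K : ℝ} (hbound : ∀ x y, ‖f x y‖ ≤ K) :
    ∫ ω, f (X ω) (Y ω) ∂P = ∫ ω, ∫ ω', f (X ω) (Y ω') ∂P ∂P := by
  have := Measure.isProbabilityMeasure_map (μ := P) hX.aemeasurable
  have := Measure.isProbabilityMeasure_map (μ := P) hY.aemeasurable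
  have hinner : ∀ x, ∫ y, f x y ∂(P.map Y) = ∫ ω', f x (Y ω') ∂P := fun x =>
    integral_map hY.aemeasurable
      (hf.comp_measurable (g := fun y => (x, y)) measurable_prodMk_left).aestronglyMeasurable
  calc ∫ ω, f (X ω) (Y ω) ∂P = ∫ p, Function.uncurry f p ∂(P.map fun ω => (X ω, Y ω)) :=
        (integral_map (hX.prodMk hY).aemeasurable hf.aestronglyMeasurable).symm
    _ = ∫ x, ∫ y, f x y ∂(P.map Y) ∂(P.map X) := by
        rw [(indepFun_iff_map_prod_eq_prod_map_map hX.aemeasurable hY.aemeasurable).1 h]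
        exact integral_prod _ (.of_bound hf.aestronglyMeasurable K (.of_forall fun p => hbound _ _))
    _ = ∫ ω, ∫ y, f (X ω) y ∂(P.map Y) ∂P := integral_map hX.aemeasurable
        hf.integral_prod_right.aestronglyMeasurable
    _ = ∫ ω, ∫ ω', f (X ω) (Y ω') ∂P ∂P := by simp only [hinner]

theorem map_restrict_comp_prodMk_le_of_indepFun (hX : Measurable X) (hY : Measurable Y)
    (h : IndepFun X Y P) {f : 𝒳 → 𝒴 → 𝒵} (hf : Measurable (Function.uncurry f)) {S : Set 𝒳}
    (hS : MeasurableSet S) {ρ : Measure 𝒵} (hle : ∀ x ∈ S, P.map (fun ω => f x (Y ω)) ≤ ρ) :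
    (P.restrict (X ⁻¹' S)).map (fun ω => f (X ω) (Y ω)) ≤ ρ := by
  have := Measure.isProbabilityMeasure_map (μ := P) hX.aemeasurable
  have := Measure.isProbabilityMeasure_map (μ := P) hY.aemeasurable
  have hfXY : Measurable fun ω => f (X ω) (Y ω) := hf.comp (hX.prodMk hY)
  refine Measure.le_iff.2 fun s hs => ?_
  have hT : MeasurableSet (Prod.fst ⁻¹' S ∩ Function.uncurry f ⁻¹' s) :=
    (measurable_fst hS).inter (hf hs)
  calc (P.restrict (X ⁻¹' S)).map (fun ω => f (X ω) (Y ω)) s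
      = P.map (fun ω => (X ω, Y ω)) (Prod.fst ⁻¹' S ∩ Function.uncurry f ⁻¹' s) := by
        rw [Measure.map_apply hfXY hs, Measure.restrict_apply (hfXY hs),
          Measure.map_apply (hX.prodMk hY) hT, Set.inter_comm]
        rfl
    _ = ∫⁻ x, P.map Y (Prod.mk x ⁻¹' (Prod.fst ⁻¹' S ∩ Function.uncurry f ⁻¹' s))
          ∂(P.map X) := by
        rw [(indepFun_iff_map_prod_eq_prod_map_map hX.aemeasurable hY.aemeasurable).1 h,
          Measure.prod_apply hT]
    _ ≤ ∫⁻ _, ρ s ∂(P.map X) := by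
        refine lintegral_mono fun x => ?_
        by_cases hx : x ∈ S
        · refine le_trans (le_of_eq ?_) (hle x hx s)
          have hfY : Measurable fun ω => f x (Y ω) := hf.of_uncurry_left.comp hY
          rw [Measure.map_apply hfY hs, Measure.map_apply hY (measurable_prodMk_left hT)]
          simp [Set.preimage, hx]
        · simp [Set.preimage, hx]
    _ = ρ s := by simp

end Independence

section GaussianSums

variable {Ω : Type*} [MeasurableSpace Ω] {P : Measure Ω}

theorem hasLaw_sum_mul_gaussianReal {ι : Type*} [Fintype ι] {X : ι → Ω → ℝ} {v : NNReal}
    (hX : ∀ i, HasLaw (X i) (gaussianReal 0 v) P) (hi : iIndepFun X P) (w : ι → ℝ) :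
    HasLaw (fun ω => ∑ i, w i * X i ω) (gaussianReal 0 ((∑ i, w i ^ 2).toNNReal * v)) P := by
  have := hi.isProbabilityMeasure
  have hwX : iIndepFun (fun i ω => w i * X i ω) P :=
    hi.comp (fun i x => w i * x) fun i => measurable_const.mul measurable_id
  have hmeas : ∀ i, AEMeasurable (fun ω => w i * X i ω) P := fun i =>
    (hX i).aemeasurable.const_mul _
  have hsum : AEMeasurable (fun ω => ∑ i, w i * X i ω) P :=
    Finset.aemeasurable_fun_sum _ fun i _ => hmeas i
  refine ⟨hsum, ?_⟩
  have := Measure.isProbabilityMeasure_map (μ := P) hsum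
  refine Measure.ext_of_charFun (funext fun t => ?_)
  rw [hwX.charFun_map_fun_sum_eq_prod hmeas, Finset.prod_apply, charFun_gaussianReal,
    NNReal.coe_mul, Real.coe_toNNReal _ (Finset.sum_nonneg fun i _ => sq_nonneg (w i))]
  have hfactor : ∀ i, charFun (P.map fun ω => w i * X i ω) t =
      Complex.exp (-(w i ^ 2 * (v * t ^ 2 / 2))) := fun i => by
    rw [(gaussianReal_const_mul (hX i) (w i)).map_eq, charFun_gaussianReal]
    congr 1
    push_cast
    ring_nf
  simp_rw [hfactor, ← Complex.exp_sum]
  congr 1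
  push_cast
  rw [Finset.sum_neg_distrib, ← Finset.sum_mul]
  ring

theorem gaussianReal_le_smul_gaussianReal {κ : ℝ} (hκ : 0 < κ) (hκ1 : κ ≤ 1) {w s : NNReal}
    (hle : κ * s ≤ w) (hws : w ≤ s) :
    gaussianReal 0 w ≤ ENNReal.ofReal (√κ)⁻¹ • gaussianReal 0 s := by
  have hone : (1 : ℝ) ≤ (√κ)⁻¹ := (one_le_inv₀ (by positivity)).2 (Real.sqrt_le_one.2 hκ1)
  rcases eq_or_ne s 0 with rfl | hs
  · obtain rfl : w = 0 := le_antisymm hws zero_le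
    refine Measure.le_iff.2 fun A _ => ?_
    rw [Measure.smul_apply, smul_eq_mul]
    exact le_mul_of_one_le_left' (by simpa using ENNReal.ofReal_le_ofReal hone)
  have : (0 : ℝ) < s := by positivity
  have hw0 : (0 : ℝ) < w := (by positivity : 0 < κ * s).trans_le hle
  have hw : w ≠ 0 := by exact_mod_cast hw0.ne'
  rw [gaussianReal_of_var_ne_zero _ hw, gaussianReal_of_var_ne_zero _ hs,
    ← withDensity_smul _ (measurable_gaussianPDF _ _)]
  refine withDensity_mono (.of_forall fun x => ?_)
  rw [Pi.smul_apply, smul_eq_mul, gaussianPDF, gaussianPDF, ← ENNReal.ofReal_mul (by positivity)]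
  refine ENNReal.ofReal_le_ofReal ?_
  have hws' : (w : ℝ) ≤ s := by exact_mod_cast hws
  calc gaussianPDFReal 0 w x
      = (√(2 * Real.pi * w))⁻¹ * Real.exp (-(x ^ 2 / (2 * w))) := by
        simp [gaussianPDFReal, neg_div]
    _ ≤ (√(κ * (2 * Real.pi * s)))⁻¹ * Real.exp (-(x ^ 2 / (2 * s))) := by
        have : κ * (2 * Real.pi * s) ≤ 2 * Real.pi * w := by
          nlinarith [mul_le_mul_of_nonneg_left hle Real.two_pi_pos.le]
        gcongr
    _ = (√κ)⁻¹ * gaussianPDFReal 0 s x := by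
        rw [Real.sqrt_mul hκ.le, mul_inv, mul_assoc]
        simp [gaussianPDFReal, neg_div]

end GaussianSums

section LowRankLayer

variable {Ω : Type*} [MeasurableSpace Ω] {N r m : ℕ} {va vb : NNReal}

/-- The parameters of one random low-rank layer: `C` is uniform on the matrices with orthonormal
columns, `A` and `b` have independent centred Gaussian entries of variance `va` and `vb`, and `C`,
`A`, `b` are independent. -/
structure IsRandomLowRankLayer (P : Measure Ω) (va vb : NNReal)
    (C : Ω → Matrix (Fin N) (Fin r) ℝ) (A : Ω → Matrix (Fin r) (Fin m) ℝ) (b : Ω → Fin r → ℝ) :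
    Prop where
  measurable_C : Measurable C
  measurable_A : Measurable A
  measurable_b : Measurable b
  law_C : IsUniformOrthonormal (P.map C)
  law_A : ∀ k j, HasLaw (fun ω => A ω k j) (gaussianReal 0 va) P
  law_b : ∀ k, HasLaw (fun ω => b ω k) (gaussianReal 0 vb) P
  indep_entries_A : iIndepFun (fun (p : Fin r × Fin m) ω => A ω p.1 p.2) P
  indep_entries_b : iIndepFun (fun k ω => b ω k) P
  indep_A_b : IndepFun A b P
  indep_C_Ab : IndepFun C (fun ω => (A ω, b ω)) P

/-- The preactivation map `C (A y + c b)` of a layer at the input `p = (y, c)`. The layer itself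
has `c = 1`; keeping the coefficient `c` of the bias makes the map linear in the input. -/
def layerMap (C : Matrix (Fin N) (Fin r) ℝ) (A : Matrix (Fin r) (Fin m) ℝ) (b : Fin r → ℝ)
    (p : (Fin m → ℝ) × ℝ) : Fin N → ℝ :=
  C *ᵥ (A *ᵥ p.1 + p.2 • b)

/-- The covariance of an entry of `A y + c b` at two inputs `(y, c)`, when the entries of `A` and
`b` are independent of variance `va` and `vb`. -/
def inputCov (va vb : NNReal) (p q : (Fin m → ℝ) × ℝ) : ℝ :=
  va * (p.1 ⬝ᵥ q.1) + vb * (p.2 * q.2)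

theorem layerMap_comb (C : Matrix (Fin N) (Fin r) ℝ) (A : Matrix (Fin r) (Fin m) ℝ)
    (b : Fin r → ℝ) (s t : ℝ) (p q : (Fin m → ℝ) × ℝ) :
    layerMap C A b (s • p + t • q) = s • layerMap C A b p + t • layerMap C A b q := by
  simp only [layerMap, ← Matrix.mulVec_smul, ← Matrix.mulVec_add, Prod.fst_add, Prod.snd_add,
    Prod.smul_fst, Prod.smul_snd]
  congr 1
  simp only [Matrix.mulVec_add, Matrix.mulVec_smul, smul_eq_mul, add_smul, smul_add, mul_smul]
  abel

theorem inputCov_comb_self (s t : ℝ) (p q : (Fin m → ℝ) × ℝ) :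
    inputCov va vb (s • p + t • q) (s • p + t • q) =
      s ^ 2 * inputCov va vb p p + 2 * (s * t) * inputCov va vb p q +
        t ^ 2 * inputCov va vb q q := by
  simp only [inputCov, Prod.fst_add, Prod.snd_add, Prod.smul_fst, Prod.smul_snd, add_dotProduct,
    dotProduct_add, smul_dotProduct, dotProduct_smul, smul_eq_mul, dotProduct_comm q.1 p.1]
  ring

theorem inputCov_self_nonneg (p : (Fin m → ℝ) × ℝ) : 0 ≤ inputCov va vb p p :=
  add_nonneg (mul_nonneg va.coe_nonneg (dotProduct_self_nonneg _))
    (mul_nonneg vb.coe_nonneg (mul_self_nonneg _))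

@[fun_prop]
theorem measurable_inputCov :
    Measurable fun p : ((Fin m → ℝ) × ℝ) × ((Fin m → ℝ) × ℝ) => inputCov va vb p.1 p.2 :=
  Continuous.measurable (by unfold inputCov; fun_prop)

theorem measurable_layerMap :
    Measurable fun p : (((Fin m → ℝ) × ℝ) × Matrix (Fin N) (Fin r) ℝ) ×
      (Matrix (Fin r) (Fin m) ℝ × (Fin r → ℝ)) => layerMap p.1.2 p.2.1 p.2.2 p.1.1 :=
  Continuous.measurable (by unfold layerMap; fun_prop)

namespace IsRandomLowRankLayer

variable {P : Measure Ω} {C : Ω → Matrix (Fin N) (Fin r) ℝ} {A : Ω → Matrix (Fin r) (Fin m) ℝ}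
  {b : Ω → Fin r → ℝ}

theorem hasLaw_dotProduct (h : IsRandomLowRankLayer P va vb C A b) (v : Fin r → ℝ)
    (p : (Fin m → ℝ) × ℝ) :
    HasLaw (fun ω => v ⬝ᵥ (A ω *ᵥ p.1 + p.2 • b ω))
      (gaussianReal 0 (inputCov va vb p p * (v ⬝ᵥ v)).toNNReal) P := by
  have hA := hasLaw_sum_mul_gaussianReal (fun q : Fin r × Fin m => h.law_A q.1 q.2)
    h.indep_entries_A fun q => v q.1 * p.1 q.2
  have hb := hasLaw_sum_mul_gaussianReal h.law_b h.indep_entries_b fun k => v k * p.2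
  have hind : IndepFun (fun ω => ∑ q : Fin r × Fin m, v q.1 * p.1 q.2 * A ω q.1 q.2)
      (fun ω => ∑ k, v k * p.2 * b ω k) P :=
    h.indep_A_b.comp
      (φ := fun M : Matrix (Fin r) (Fin m) ℝ => ∑ q : Fin r × Fin m, v q.1 * p.1 q.2 * M q.1 q.2)
      (ψ := fun u : Fin r → ℝ => ∑ k, v k * p.2 * u k)
      (Continuous.measurable (by fun_prop)) (by fun_prop)
  have hlin : (fun ω => v ⬝ᵥ (A ω *ᵥ p.1 + p.2 • b ω)) =
      (fun ω => ∑ q : Fin r × Fin m, v q.1 * p.1 q.2 * A ω q.1 q.2) +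
        fun ω => ∑ k, v k * p.2 * b ω k := by
    ext ω
    simp only [dotProduct, Matrix.mulVec, Pi.add_apply, Pi.smul_apply, smul_eq_mul, mul_add,
      Finset.sum_add_distrib, Finset.mul_sum, Fintype.sum_prod_type]
    simp only [mul_assoc, mul_comm (A ω _ _)]
  have hvar : (inputCov va vb p p * (v ⬝ᵥ v)).toNNReal =
      (∑ q : Fin r × Fin m, (v q.1 * p.1 q.2) ^ 2).toNNReal * va +
        (∑ k, (v k * p.2) ^ 2).toNNReal * vb := by
    rw [← NNReal.coe_inj, Real.coe_toNNReal _ (mul_nonneg (inputCov_self_nonneg p)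
      (dotProduct_self_nonneg v)), NNReal.coe_add, NNReal.coe_mul, NNReal.coe_mul,
      Real.coe_toNNReal _ (Finset.sum_nonneg fun _ _ => sq_nonneg _),
      Real.coe_toNNReal _ (Finset.sum_nonneg fun _ _ => sq_nonneg _)]
    simp only [inputCov, dotProduct, mul_pow, Fintype.sum_prod_type, ← Finset.mul_sum,
      ← Finset.sum_mul, ← sq]
    ring
  rw [hlin, hvar]
  have hlaw := gaussianReal_add_gaussianReal_of_indepFun hind hA.map_eq hb.map_eq
  exact ⟨hA.aemeasurable.add hb.aemeasurable, by rw [hlaw, add_zero]⟩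

end IsRandomLowRankLayer

end LowRankLayer

theorem integral_cos_add_gaussianReal (v : NNReal) (θ : ℝ) :
    ∫ x, Real.cos (x + θ) ∂(gaussianReal 0 v) = Real.exp (-(v / 2)) * Real.cos θ := by
  have h := charFun_gaussianReal (μ := 0) (v := v) 1
  simp only [charFun_apply_real, Complex.ofReal_one, one_mul, Complex.ofReal_zero, mul_zero,
    zero_mul, zero_sub, one_pow, mul_one] at h
  have hint : Integrable (fun x : ℝ => Complex.exp (θ * Complex.I) * Complex.exp (x * Complex.I))
      (gaussianReal 0 v) :=
    (Integrable.of_bound (by fun_prop) 1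
      (.of_forall fun x => (Complex.norm_exp_ofReal_mul_I x).le)).const_mul _
  calc ∫ x, Real.cos (x + θ) ∂(gaussianReal 0 v)
      = ∫ x : ℝ, (Complex.exp (θ * Complex.I) * Complex.exp (x * Complex.I)).re
          ∂(gaussianReal 0 v) := by
        simp only [← Complex.exp_add, ← add_mul, ← Complex.ofReal_add, add_comm θ,
          Complex.exp_ofReal_mul_I_re]
    _ = (∫ x : ℝ, Complex.exp (θ * Complex.I) * Complex.exp (x * Complex.I)
          ∂(gaussianReal 0 v)).re := integral_re hint
    _ = (Complex.exp (θ * Complex.I) * (Real.exp (-(v / 2)) : ℝ)).re := by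
        rw [integral_const_mul, h]; push_cast; rfl
    _ = Real.exp (-(v / 2)) * Real.cos θ := by
        rw [Complex.re_mul_ofReal, Complex.exp_ofReal_mul_I_re, mul_comm]

theorem inner_cexp_sub_ofReal (x y c : ℝ) :
    inner ℝ (Complex.exp (x * Complex.I) - c) (Complex.exp (y * Complex.I) - c) =
      Real.cos (x - y) - c * Real.cos x - c * Real.cos y + c ^ 2 := by
  simp only [Complex.inner, Complex.mul_re, Complex.conj_re, Complex.conj_im, Complex.sub_re,
    Complex.sub_im, Complex.exp_ofReal_mul_I_re, Complex.exp_ofReal_mul_I_im, Complex.ofReal_re,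
    Complex.ofReal_im, Real.cos_sub]
  ring

theorem integral_inner_cexp_sub_ofReal {Ω : Type*} [MeasurableSpace Ω] {P : Measure Ω}
    [IsProbabilityMeasure P] {X Y : Ω → ℝ} (hX : Measurable X) (hY : Measurable Y) (c : ℝ) :
    ∫ ω, inner ℝ (Complex.exp (X ω * Complex.I) - c) (Complex.exp (Y ω * Complex.I) - c) ∂P =
      ∫ ω, Real.cos (X ω - Y ω) ∂P - c * ∫ ω, Real.cos (X ω) ∂P - c * ∫ ω, Real.cos (Y ω) ∂P +
        c ^ 2 := by
  have hcos : ∀ {g : Ω → ℝ}, Measurable g → Integrable (fun ω => Real.cos (g ω)) P := fun hg =>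
    .of_bound (by fun_prop) 1 (.of_forall fun ω => Real.abs_cos_le_one _)
  have hXY := hcos (g := fun ω => X ω - Y ω) (hX.sub hY)
  have hcX := (hcos hX).const_mul c
  have hcY := (hcos hY).const_mul c
  simp only [inner_cexp_sub_ofReal]
  rw [integral_add (by fun_prop) (by fun_prop), integral_sub (by fun_prop) hcY,
    integral_sub hXY hcX, integral_const_mul, integral_const_mul]
  simp

namespace IsRandomLowRankLayer

variable {Ω : Type*} [MeasurableSpace Ω] {P : Measure Ω} {N r m : ℕ} {va vb : NNReal}
  {C : Ω → Matrix (Fin N) (Fin r) ℝ} {A : Ω → Matrix (Fin r) (Fin m) ℝ} {b : Ω → Fin r → ℝ}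

theorem hasLaw_layerMap_apply (h : IsRandomLowRankLayer P va vb C A b)
    (M : Matrix (Fin N) (Fin r) ℝ) (p : (Fin m → ℝ) × ℝ) (i : Fin N) :
    HasLaw (fun ω => layerMap M (A ω) (b ω) p i)
      (gaussianReal 0 (inputCov va vb p p * rowNormSq M i).toNNReal) P :=
  h.hasLaw_dotProduct (M i) p

theorem integral_cos_dotProduct_layerMap_const (h : IsRandomLowRankLayer P va vb C A b)
    (M : Matrix (Fin N) (Fin r) ℝ) (q : (Fin m → ℝ) × ℝ) (ξ : Fin N → ℝ) :
    ∫ ω, Real.cos (ξ ⬝ᵥ layerMap M (A ω) (b ω) q) ∂P =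
      Real.exp (-(inputCov va vb q q / 2 * ((ξ ᵥ* M) ⬝ᵥ (ξ ᵥ* M)))) := by
  have hcos := (h.hasLaw_dotProduct (ξ ᵥ* M) q).integral_comp (f := Real.cos) (by fun_prop)
  have hgaussian := integral_cos_add_gaussianReal
    (inputCov va vb q q * ((ξ ᵥ* M) ⬝ᵥ (ξ ᵥ* M))).toNNReal 0
  simp only [add_zero, Real.cos_zero, mul_one] at hgaussian
  simp only [layerMap, Matrix.dotProduct_mulVec]
  rw [Function.comp_def] at hcos
  rw [hcos, hgaussian, Real.coe_toNNReal _ (mul_nonneg (inputCov_self_nonneg q)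
    (dotProduct_self_nonneg _))]
  ring_nf

variable {p : Ω → (Fin m → ℝ) × ℝ}

theorem measurable_layerMap_apply (h : IsRandomLowRankLayer P va vb C A b) (hp : Measurable p)
    (i : Fin N) : Measurable fun ω => layerMap (C ω) (A ω) (b ω) (p ω) i :=
  (measurable_pi_apply i).comp <| measurable_layerMap.comp <|
    (hp.prodMk h.measurable_C).prodMk (h.measurable_A.prodMk h.measurable_b)

variable [IsProbabilityMeasure P]

theorem indepFun_input_C_Ab (h : IsRandomLowRankLayer P va vb C A b) (hp : Measurable p)
    (hind : IndepFun p (fun ω => (C ω, A ω, b ω)) P) :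
    IndepFun (fun ω => (p ω, C ω)) (fun ω => (A ω, b ω)) P :=
  indepFun_prodMk_left_of_prodMk_right hp h.measurable_C (h.measurable_A.prodMk h.measurable_b)
    hind h.indep_C_Ab

theorem integral_cos_dotProduct_layerMap (h : IsRandomLowRankLayer P va vb C A b)
    (hp : Measurable p) (hind : IndepFun p (fun ω => (C ω, A ω, b ω)) P) (hN : N ≠ 0)
    (ξ : Fin N → ℝ) :
    ∫ ω, Real.cos (ξ ⬝ᵥ layerMap (C ω) (A ω) (b ω) (p ω)) ∂P =
      ∫ ω, rowLaplace (P.map C) (inputCov va vb (p ω) (p ω) / 2 * (ξ ⬝ᵥ ξ)) ∂P := by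
  have hmeas : Measurable fun x : (((Fin m → ℝ) × ℝ) × Matrix (Fin N) (Fin r) ℝ) ×
      (Matrix (Fin r) (Fin m) ℝ × (Fin r → ℝ)) =>
        Real.cos (ξ ⬝ᵥ layerMap x.1.2 x.2.1 x.2.2 x.1.1) :=
    Continuous.measurable (by unfold layerMap; fun_prop)
  rw [integral_comp_prodMk_of_indepFun (hp.prodMk h.measurable_C)
    (h.measurable_A.prodMk h.measurable_b) (h.indepFun_input_C_Ab hp hind)
    (f := fun x z => Real.cos (ξ ⬝ᵥ layerMap x.2 z.1 z.2 x.1)) hmeas.stronglyMeasurable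
    fun _ _ => Real.abs_cos_le_one _]
  simp only [h.integral_cos_dotProduct_layerMap_const]
  rw [integral_comp_prodMk_of_indepFun (K := 1) hp h.measurable_C
    (hind.comp measurable_id measurable_fst)
    (f := fun q M => Real.exp (-(inputCov va vb q q / 2 * ((ξ ᵥ* M) ⬝ᵥ (ξ ᵥ* M)))))
    (Continuous.stronglyMeasurable (by unfold Function.uncurry inputCov; fun_prop)) fun q M => ?_]
  · refine integral_congr_ae (.of_forall fun ω => ?_)
    dsimp only
    rw [← h.law_C.integral_exp_neg_vecMul hN, integral_map h.measurable_C.aemeasurable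
      (Continuous.aestronglyMeasurable (by fun_prop))]
  · rw [Real.norm_of_nonneg (Real.exp_nonneg _), Real.exp_le_one_iff, neg_nonpos]
    have := inputCov_self_nonneg (va := va) (vb := vb) q
    have := dotProduct_self_nonneg (ξ ᵥ* M)
    positivity

theorem integral_cos_layerMap_apply (h : IsRandomLowRankLayer P va vb C A b)
    (hp : Measurable p) (hind : IndepFun p (fun ω => (C ω, A ω, b ω)) P) (i : Fin N) :
    ∫ ω, Real.cos (layerMap (C ω) (A ω) (b ω) (p ω) i) ∂P =
      ∫ ω, rowLaplace (P.map C) (inputCov va vb (p ω) (p ω) / 2) ∂P := by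
  simpa using h.integral_cos_dotProduct_layerMap hp hind i.pos.ne' (Pi.single i 1)

theorem integral_cos_layerMap_apply_sub (h : IsRandomLowRankLayer P va vb C A b)
    (hp : Measurable p) (hind : IndepFun p (fun ω => (C ω, A ω, b ω)) P) {i j : Fin N}
    (hij : i ≠ j) :
    ∫ ω, Real.cos (layerMap (C ω) (A ω) (b ω) (p ω) i - layerMap (C ω) (A ω) (b ω) (p ω) j) ∂P =
      ∫ ω, rowLaplace (P.map C) (inputCov va vb (p ω) (p ω)) ∂P := by
  have hsq : (Pi.single i 1 - Pi.single j 1 : Fin N → ℝ) ⬝ᵥ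
      (Pi.single i 1 - Pi.single j 1) = 2 := by norm_num [hij, hij.symm]
  have hcos := h.integral_cos_dotProduct_layerMap hp hind i.pos.ne'
    (Pi.single i 1 - Pi.single j 1)
  rw [hsq] at hcos
  simpa only [sub_dotProduct, single_one_dotProduct, div_mul_cancel₀ _ (two_ne_zero' ℝ)] using hcos

theorem integral_inner_cexp_layerMap_sub_ofReal (h : IsRandomLowRankLayer P va vb C A b)
    (hp : Measurable p) (hind : IndepFun p (fun ω => (C ω, A ω, b ω)) P) {i j : Fin N}
    (hij : i ≠ j) (c : ℝ) :
    ∫ ω, inner ℝ (Complex.exp (layerMap (C ω) (A ω) (b ω) (p ω) i * Complex.I) - c)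
        (Complex.exp (layerMap (C ω) (A ω) (b ω) (p ω) j * Complex.I) - c) ∂P =
      ∫ ω, rowLaplace (P.map C) (inputCov va vb (p ω) (p ω)) ∂P -
        2 * c * ∫ ω, rowLaplace (P.map C) (inputCov va vb (p ω) (p ω) / 2) ∂P + c ^ 2 := by
  rw [integral_inner_cexp_sub_ofReal (h.measurable_layerMap_apply hp i)
    (h.measurable_layerMap_apply hp j), h.integral_cos_layerMap_apply_sub hp hind hij,
    h.integral_cos_layerMap_apply hp hind, h.integral_cos_layerMap_apply hp hind]
  ring

end IsRandomLowRankLayer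

theorem IsUniformOrthonormal.rowLaplace_mem_Icc {N r : ℕ} {ν : Measure (Matrix (Fin N) (Fin r) ℝ)}
    (hν : IsUniformOrthonormal ν) {s : ℝ} (hs : 0 ≤ s) : rowLaplace ν s ∈ Set.Icc 0 1 := by
  have := hν.isProbabilityMeasure
  rcases Nat.eq_zero_or_pos N with rfl | hN
  · simp [rowLaplace]
  rw [hν.rowLaplace_eq_integral s ⟨0, hN⟩]
  refine ⟨integral_nonneg fun M => Real.exp_nonneg _, ?_⟩
  refine (integral_mono (hν.integrable_exp_neg_rowNormSq hs _) (integrable_const 1)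
    fun M => Real.exp_le_one_iff.2 ?_).trans (by simp)
  exact neg_nonpos.2 (mul_nonneg hs (rowNormSq_nonneg M _))

section LayerAsymptotics

variable {Ω ι : Type*} [MeasurableSpace Ω] {P : Measure Ω} [IsProbabilityMeasure P] {l : Filter ι}
  {N r : ι → ℕ} {γ : ℝ}

theorem tendsto_integral_rowLaplace [l.IsCountablyGenerated]
    {ν : ∀ n, Measure (Matrix (Fin (N n)) (Fin (r n)) ℝ)} (hν : ∀ n, IsUniformOrthonormal (ν n))
    (hN : Tendsto N l atTop) (hr : Tendsto (fun n => (r n : ℝ) / N n) l (𝓝 γ)) {T : ι → Ω → ℝ}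
    (hTm : ∀ n, Measurable (T n)) (hT0 : ∀ n ω, 0 ≤ T n ω) {τ : ℝ}
    (hT : TendstoInMeasure P T l (fun _ => τ)) :
    Tendsto (fun n => ∫ ω, rowLaplace (ν n) (T n ω) ∂P) l (𝓝 (Real.exp (-(γ * τ)))) := by
  have := fun n => (hν n).isProbabilityMeasure
  refine tendsto_integral_of_tendstoInMeasure_const (K := 1)
    (fun n => (measurable_rowLaplace.comp (hTm n)).aestronglyMeasurable) (fun n ω => ?_) ?_
  · obtain ⟨hlow, hup⟩ := (hν n).rowLaplace_mem_Icc (hT0 n ω)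
    rwa [Real.norm_of_nonneg hlow]
  rcases l.eq_or_neBot with rfl | _
  · exact fun _ _ => tendsto_bot
  have hτ : 0 ≤ τ := mem_of_tendstoInMeasure_const isClosed_Ici hT hT0
  have hmax : Tendsto (fun x : ι × ℝ => max x.2 0) (l ×ˢ 𝓝 τ) (𝓝 τ) := by
    simpa [hτ] using (tendsto_snd (f := l) (g := 𝓝 τ)).max (tendsto_const_nhds (x := (0 : ℝ)))
  have hcont := tendsto_rowLaplace (fun x : ι × ℝ => hν x.1) (hN.comp tendsto_fst)
    (hr.comp tendsto_fst) (fun x => le_max_right x.2 0) hmax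
  refine (tendstoInMeasure_comp_of_tendsto_prod_nhds
    (Φ := fun n x => rowLaplace (ν n) (max x 0)) hT hcont).congr_left fun n => ?_
  exact .of_forall fun ω => by simp only [max_eq_left (hT0 n ω)]

variable {m : ι → ℕ} {va vb : ι → NNReal} {C : ∀ n, Ω → Matrix (Fin (N n)) (Fin (r n)) ℝ}
  {A : ∀ n, Ω → Matrix (Fin (r n)) (Fin (m n)) ℝ} {b : ∀ n, Ω → Fin (r n) → ℝ}
  {p : ∀ n, Ω → (Fin (m n) → ℝ) × ℝ}

theorem tendstoInMeasure_average_cexp_layerMap [l.IsCountablyGenerated]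
    (h : ∀ n, IsRandomLowRankLayer P (va n) (vb n) (C n) (A n) (b n)) (hN : Tendsto N l atTop)
    (hr : Tendsto (fun n => (r n : ℝ) / N n) l (𝓝 γ)) (hp : ∀ n, Measurable (p n))
    (hind : ∀ n, IndepFun (p n) (fun ω => (C n ω, A n ω, b n ω)) P) {τ : ℝ}
    (hτ : TendstoInMeasure P (fun n ω => inputCov (va n) (vb n) (p n ω) (p n ω)) l fun _ => τ) :
    TendstoInMeasure P (fun n ω => (N n : ℝ)⁻¹ • ∑ i,
      Complex.exp (layerMap (C n ω) (A n ω) (b n ω) (p n ω) i * Complex.I)) l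
      fun _ => (Real.exp (-(γ * τ / 2)) : ℂ) := by
  set c : ℝ := Real.exp (-(γ * τ / 2)) with hc
  have hcov : ∀ n, Measurable fun ω => inputCov (va n) (vb n) (p n ω) (p n ω) := fun n =>
    measurable_inputCov.comp ((hp n).prodMk (hp n))
  have hsub := tendsto_integral_rowLaplace (fun n => (h n).law_C) hN hr hcov
    (fun n ω => inputCov_self_nonneg _) hτ
  have hone := tendsto_integral_rowLaplace (fun n => (h n).law_C) hN hr
    (fun n => (hcov n).div_const 2) (fun n ω => div_nonneg (inputCov_self_nonneg _) zero_le_two)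
    (tendstoInMeasure_comp_of_continuousAt (Φ := fun x : ℝ => x / 2) hτ
      (Continuous.continuousAt (by fun_prop)))
  have hε := (hsub.sub (hone.const_mul (2 * c))).add_const (c ^ 2)
  have hzero : Real.exp (-(γ * τ)) - 2 * c * Real.exp (-(γ * (τ / 2))) + c ^ 2 = 0 := by
    have h1 : Real.exp (-(γ * τ)) = c ^ 2 := by rw [hc, ← Real.exp_nat_mul]; ring_nf
    rw [h1, ← mul_div_assoc, ← hc]
    ring
  rw [hzero] at hε
  have hweak := tendstoInMeasure_average_of_integral_inner_le hN (P := P)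
    (D := fun n i ω => Complex.exp (layerMap (C n ω) (A n ω) (b n ω) (p n ω) i * Complex.I) - c)
    (fun n i => by
      have := (h n).measurable_layerMap_apply (hp n) i
      exact Measurable.aestronglyMeasurable (by fun_prop)) (K := 1 + ‖(c : ℂ)‖)
    (fun n i ω => (norm_sub_le _ _).trans_eq (by rw [Complex.norm_exp_ofReal_mul_I])) hε
    fun n i j hij =>
      ((h n).integral_inner_cexp_layerMap_sub_ofReal (hp n) (hind n) hij c).le
  refine ((tendstoInMeasure_add_const hweak (tendstoInMeasure_const (c : ℂ))).congr' ?_ ?_)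
  · filter_upwards [hN.eventually_ne_atTop 0] with n hn
    have hn' : (N n : ℂ) ≠ 0 := by exact_mod_cast hn
    refine .of_forall fun ω => ?_
    simp [Finset.sum_sub_distrib, mul_sub, hn']
  · simp

end LayerAsymptotics

/-- The triangular array `u n ω i`, `i < N n`, is dominated by `ρ` if, outside events of vanishing
probability, the average over `i` of the laws of `u n · i` is at most `ρ`. -/
def IsDominatedArray {Ω ι : Type*} [MeasurableSpace Ω] (P : Measure Ω) (l : Filter ι) {N : ι → ℕ}
    (u : ∀ n, Ω → Fin (N n) → ℝ) (ρ : Measure ℝ) : Prop :=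
  ∃ E : ι → Set Ω, (∀ n, MeasurableSet (E n)) ∧ Tendsto (fun n => P (E n)ᶜ) l (𝓝 0) ∧
    ∀ n, ∑ i, (P.restrict (E n)).map (fun ω => u n ω i) ≤ (N n : ENNReal) • ρ

theorem IsRandomLowRankLayer.map_restrict_layerMap_apply_le {Ω : Type*} [MeasurableSpace Ω]
    {P : Measure Ω} [IsProbabilityMeasure P] {N r m : ℕ} {va vb : NNReal}
    {C : Ω → Matrix (Fin N) (Fin r) ℝ} {A : Ω → Matrix (Fin r) (Fin m) ℝ} {b : Ω → Fin r → ℝ}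
    {p : Ω → (Fin m → ℝ) × ℝ} (h : IsRandomLowRankLayer P va vb C A b) (hp : Measurable p)
    (hind : IndepFun p (fun ω => (C ω, A ω, b ω)) P) {V δ : ℝ} (hδ : 0 < δ) (hδ1 : δ ≤ 1)
    (i : Fin N) :
    (P.restrict {ω | inputCov va vb (p ω) (p ω) ∈ Set.Icc (V / 2) (2 * V) ∧
        rowNormSq (C ω) i ∈ Set.Icc δ 1}).map (fun ω => layerMap (C ω) (A ω) (b ω) (p ω) i) ≤
      ENNReal.ofReal (√(δ / 4))⁻¹ • gaussianReal 0 (2 * V).toNNReal := by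
  have hcov : Measurable fun x : ((Fin m → ℝ) × ℝ) × Matrix (Fin N) (Fin r) ℝ =>
      inputCov va vb x.1 x.1 := measurable_inputCov.comp (measurable_fst.prodMk measurable_fst)
  have hrow : Measurable fun x : ((Fin m → ℝ) × ℝ) × Matrix (Fin N) (Fin r) ℝ =>
      rowNormSq x.2 i := (continuous_rowNormSq i).measurable.comp measurable_snd
  refine map_restrict_comp_prodMk_le_of_indepFun (hp.prodMk h.measurable_C)
    (h.measurable_A.prodMk h.measurable_b) (h.indepFun_input_C_Ab hp hind)
    (f := fun x z => layerMap x.2 z.1 z.2 x.1 i) ((measurable_pi_apply i).comp measurable_layerMap)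
    ((hcov measurableSet_Icc).inter (hrow measurableSet_Icc)) ?_
  rintro ⟨q, M⟩ ⟨⟨hq, hq'⟩, hM, hM'⟩
  dsimp only at hq hq' hM hM' ⊢
  rw [(h.hasLaw_layerMap_apply M q i).map_eq]
  refine gaussianReal_le_smul_gaussianReal (by positivity) (by linarith) ?_ ?_
  · rw [Real.coe_toNNReal _ (by linarith), Real.coe_toNNReal _
      (mul_nonneg (inputCov_self_nonneg q) (rowNormSq_nonneg M i))]
    calc δ / 4 * (2 * V) = V / 2 * δ := by ring
      _ ≤ _ := mul_le_mul hq hM hδ.le (inputCov_self_nonneg q)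
  · exact Real.toNNReal_le_toNNReal
      ((mul_le_of_le_one_right (inputCov_self_nonneg q) hM').trans hq')

section LayerDomination

variable {Ω ι : Type*} [MeasurableSpace Ω] {P : Measure Ω} {l : Filter ι}
  {N r : ι → ℕ} {γ : ℝ} {C : ∀ n, Ω → Matrix (Fin (N n)) (Fin (r n)) ℝ}

theorem exists_tendsto_measure_rowNormSq_notMem_Icc (hC : ∀ n, Measurable (C n))
    (hlaw : ∀ n, IsUniformOrthonormal (P.map (C n))) (hγ : 0 < γ) (hN : Tendsto N l atTop)
    (hr : Tendsto (fun n => (r n : ℝ) / N n) l (𝓝 γ)) :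
    ∃ δ > 0, δ ≤ 1 ∧
      Tendsto (fun n => P {ω | ∃ i, rowNormSq (C n ω) i ∉ Set.Icc δ 1}) l (𝓝 0) := by
  obtain ⟨δ, hδ, hlim⟩ := exists_tendsto_measure_rowNormSq_le hlaw hγ hN hr
  refine ⟨min δ 1, lt_min hδ one_pos, min_le_right _ _, ?_⟩
  refine tendsto_of_tendsto_of_tendsto_of_le_of_le tendsto_const_nhds hlim (fun _ => zero_le)
    fun n => ?_
  have hmeas : MeasurableSet {M : Matrix (Fin (N n)) (Fin (r n)) ℝ | ∃ i, rowNormSq M i ≤ δ} := by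
    rw [Set.ofPred_exists]
    exact .iUnion fun i => measurableSet_le (continuous_rowNormSq i).measurable measurable_const
  dsimp only
  rw [Measure.map_apply (hC n) hmeas]
  have horth := ae_of_ae_map (hC n).aemeasurable (hlaw n).orthonormal_columns
  refine measure_mono_ae ?_
  filter_upwards [horth] with ω hω ⟨i, hi⟩
  refine ⟨i, not_lt.1 fun hlt => hi ⟨(min_le_left _ _).trans hlt.le, rowNormSq_le_one hω i⟩⟩

variable [IsProbabilityMeasure P] {m : ι → ℕ} {va vb : ι → NNReal}
  {A : ∀ n, Ω → Matrix (Fin (r n)) (Fin (m n)) ℝ}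
  {b : ∀ n, Ω → Fin (r n) → ℝ} {p : ∀ n, Ω → (Fin (m n) → ℝ) × ℝ}

theorem exists_isDominatedArray_layerMap
    (h : ∀ n, IsRandomLowRankLayer P (va n) (vb n) (C n) (A n) (b n)) (hγ : 0 < γ)
    (hN : Tendsto N l atTop) (hr : Tendsto (fun n => (r n : ℝ) / N n) l (𝓝 γ))
    (hp : ∀ n, Measurable (p n)) (hind : ∀ n, IndepFun (p n) (fun ω => (C n ω, A n ω, b n ω)) P)
    {V : ℝ} (hV : Tendsto (fun n => P {ω | inputCov (va n) (vb n) (p n ω) (p n ω) ∉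
      Set.Icc (V / 2) (2 * V)}) l (𝓝 0)) :
    ∃ K : ENNReal, K ≠ ⊤ ∧ IsDominatedArray P l
      (fun n ω => layerMap (C n ω) (A n ω) (b n ω) (p n ω))
      (K • gaussianReal 0 (2 * V).toNNReal) := by
  obtain ⟨δ, hδ, hδ1, hlim⟩ := exists_tendsto_measure_rowNormSq_notMem_Icc
    (fun n => (h n).measurable_C) (fun n => (h n).law_C) hγ hN hr
  refine ⟨_, ENNReal.ofReal_ne_top (r := (√(δ / 4))⁻¹),
    fun n => {ω | inputCov (va n) (vb n) (p n ω) (p n ω) ∈ Set.Icc (V / 2) (2 * V)} ∩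
      ⋂ i, {ω | rowNormSq (C n ω) i ∈ Set.Icc δ 1}, fun n => ?_, ?_, fun n => ?_⟩
  · exact ((measurable_inputCov.comp ((hp n).prodMk (hp n))) measurableSet_Icc).inter
      (.iInter fun i => ((continuous_rowNormSq i).measurable.comp (h n).measurable_C)
        measurableSet_Icc)
  · refine tendsto_of_tendsto_of_tendsto_of_le_of_le tendsto_const_nhds (by simpa using hV.add hlim)
      (fun _ => zero_le) fun n => ?_
    refine (measure_mono fun ω hω => ?_).trans (measure_union_le _ _)
    simpa [imp_iff_not_or] using hω
  · refine (Finset.sum_le_card_nsmul Finset.univ _ _ fun i _ => ?_).trans_eq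
      (by rw [Finset.card_univ, Fintype.card_fin, Nat.cast_smul_eq_nsmul])
    refine (Measure.map_mono (Measure.restrict_mono_set P fun ω hω => ?_)
      ((h n).measurable_layerMap_apply (hp n) i)).trans
      ((h n).map_restrict_layerMap_apply_le (hp n) (hind n) (V := V) hδ hδ1 i)
    exact ⟨hω.1, Set.mem_iInter.1 hω.2 i⟩

end LayerDomination

section CosineDensity

open BoundedContinuousFunction

variable {μ : Measure ℝ}

theorem charFun_withDensity_ofReal {f : ℝ → ℝ} (hf : Measurable f) (hf0 : ∀ x, 0 ≤ f x)
    (s : ℝ) : charFun (μ.withDensity fun x => ENNReal.ofReal (f x)) s =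
      ∫ x, f x * Complex.exp ((s * x : ℝ) * Complex.I) ∂μ := by
  rw [charFun_apply_real, integral_withDensity_eq_integral_toReal_smul hf.ennreal_ofReal
    (.of_forall fun _ => ENNReal.ofReal_lt_top)]
  simp [ENNReal.toReal_ofReal (hf0 _)]

theorem integral_mul_cexp_eq_zero_of_integral_mul_cos_eq_zero {g : ℝ → ℝ} (hg : Integrable g μ)
    (h : ∀ s θ, ∫ x, g x * Real.cos (s * x + θ) ∂μ = 0) (s : ℝ) :
    ∫ x, g x * Complex.exp ((s * x : ℝ) * Complex.I) ∂μ = 0 := by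
  have hint : Integrable (fun x => g x * Complex.exp ((s * x : ℝ) * Complex.I)) μ :=
    hg.ofReal.mul_bdd (c := 1) (Continuous.aestronglyMeasurable (by fun_prop))
      (.of_forall fun x => (Complex.norm_exp_ofReal_mul_I _).le)
  refine Complex.ext ?_ ?_
  · rw [← RCLike.re_eq_complex_re, ← integral_re hint]
    simpa [Complex.exp_ofReal_mul_I_re, -Complex.ofReal_mul] using h s 0
  · rw [← RCLike.im_eq_complex_im, ← integral_im hint]
    simpa [Complex.exp_ofReal_mul_I_im, -Complex.ofReal_mul, ← sub_eq_add_neg,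
      Real.cos_sub_pi_div_two] using h s (-(Real.pi / 2))

theorem ae_eq_zero_of_integral_mul_cos_eq_zero {g : ℝ → ℝ} (hgm : Measurable g)
    (hg : Integrable g μ) (h : ∀ s θ, ∫ x, g x * Real.cos (s * x + θ) ∂μ = 0) : g =ᵐ[μ] 0 := by
  have habs : Integrable (fun x => |g x|) μ := hg.abs
  have hadd : Integrable (fun x => |g x| + g x) μ := habs.add hg
  have hadd0 : ∀ x, 0 ≤ |g x| + g x := fun x => by linarith [neg_abs_le (g x)]
  have := isFiniteMeasure_withDensity_ofReal habs.2
  have := isFiniteMeasure_withDensity_ofReal hadd.2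
  have hmul : ∀ {f : ℝ → ℝ} (s : ℝ), Integrable f μ →
      Integrable (fun x => (f x : ℂ) * Complex.exp ((s * x : ℝ) * Complex.I)) μ := fun s hf =>
    hf.ofReal.mul_bdd (c := 1) (Continuous.aestronglyMeasurable (by fun_prop))
      (.of_forall fun x => (Complex.norm_exp_ofReal_mul_I _).le)
  have heq : (μ.withDensity fun x => ENNReal.ofReal (|g x| + g x)) =
      μ.withDensity fun x => ENNReal.ofReal |g x| := by
    refine Measure.ext_of_charFun (funext fun s => ?_)
    rw [charFun_withDensity_ofReal (by fun_prop) hadd0,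
      charFun_withDensity_ofReal (by fun_prop) fun _ => abs_nonneg _]
    simp only [Complex.ofReal_add, add_mul]
    rw [integral_add (hmul s habs) (hmul s hg),
      integral_mul_cexp_eq_zero_of_integral_mul_cos_eq_zero hg h, add_zero]
  filter_upwards [(withDensity_eq_iff (by fun_prop) (by fun_prop)
    hadd.lintegral_lt_top.ne).1 heq] with x hx
  simpa using (ENNReal.ofReal_eq_ofReal_iff (hadd0 x) (abs_nonneg _)).1 hx

/-- The wave `x ↦ cos (s x + θ)`. -/
noncomputable def cosWave (s θ : ℝ) : ℝ →ᵇ ℝ :=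
  .ofNormedAddCommGroup (fun x => Real.cos (s * x + θ)) (by fun_prop) 1
    fun _ => Real.abs_cos_le_one _

/-- The real trigonometric polynomials, with arbitrary real frequencies. -/
noncomputable def trigPolynomials : Submodule ℝ (ℝ →ᵇ ℝ) :=
  Submodule.span ℝ (Set.range fun q : ℝ × ℝ => cosWave q.1 q.2)

variable [IsFiniteMeasure μ]

theorem topologicalClosure_map_toLp_trigPolynomials :
    (trigPolynomials.map (toLp (E := ℝ) 2 μ ℝ).toLinearMap).topologicalClosure = ⊤ := by
  rw [Submodule.topologicalClosure_eq_top_iff, Submodule.eq_bot_iff]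
  intro g hg
  have hgL : MemLp g 2 μ := Lp.memLp g
  have hgm : StronglyMeasurable g := Lp.stronglyMeasurable g
  refine Lp.ext ((ae_eq_zero_of_integral_mul_cos_eq_zero hgm.measurable
    (hgL.integrable one_le_two) fun s θ => ?_).trans (Lp.coeFn_zero ℝ 2 μ).symm)
  have horth := (Submodule.mem_orthogonal _ g).1 hg (toLp (E := ℝ) 2 μ ℝ (cosWave s θ))
    ⟨_, Submodule.subset_span ⟨(s, θ), rfl⟩, rfl⟩
  rw [L2.inner_def] at horth
  rw [← horth]
  refine integral_congr_ae ?_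
  filter_upwards [coeFn_toLp (E := ℝ) (p := 2) μ ℝ (cosWave s θ)] with x hx
  rw [hx]
  rfl

theorem memLp_coe_boundedContinuousFunction (f : ℝ →ᵇ ℝ) (p : ENNReal) : MemLp f p μ :=
  .of_bound f.continuous.aestronglyMeasurable ‖f‖ (.of_forall f.norm_coe_le_norm)

theorem exists_mem_trigPolynomials_eLpNorm_sub_le {f : ℝ → ℝ} (hf : MemLp f 2 μ) {ε : ENNReal}
    (hε : ε ≠ 0) : ∃ p ∈ trigPolynomials, eLpNorm (f - ⇑p) 2 μ ≤ ε := by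
  have hmem : hf.toLp f ∈ closure
      (trigPolynomials.map (toLp (E := ℝ) 2 μ ℝ).toLinearMap : Set (Lp ℝ 2 μ)) := by
    rw [← Submodule.topologicalClosure_coe, topologicalClosure_map_toLp_trigPolynomials]
    trivial
  obtain ⟨_, ⟨p, hp, rfl⟩, hdist⟩ := EMetric.mem_closure_iff.1 hmem ε (pos_iff_ne_zero.2 hε)
  refine ⟨p, hp, (eLpNorm_congr_ae ?_).trans_le ((Lp.edist_def _ _).symm.trans_le hdist.le)⟩
  filter_upwards [hf.coeFn_toLp, coeFn_toLp (E := ℝ) (p := 2) μ ℝ p] with x hfx hpx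
  rw [Pi.sub_apply, Pi.sub_apply, hfx]
  exact congrArg _ hpx.symm

end CosineDensity

section SumCauchySchwarz

variable {Ω κ : Type*} [MeasurableSpace Ω] [Fintype κ] {m : Measure Ω} {X Y : κ → Ω → ℝ}
  {μ μ' : Measure ℝ} {f g p q : ℝ → ℝ}

theorem lintegral_sum_comp_le (hX : ∀ k, Measurable (X k)) (hXμ : ∑ k, m.map (X k) ≤ μ)
    {Φ : ℝ → ENNReal} (hΦ : Measurable Φ) : ∫⁻ ω, ∑ k, Φ (X k ω) ∂m ≤ ∫⁻ x, Φ x ∂μ := by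
  rw [lintegral_finsetSum (f := fun k ω => Φ (X k ω)) _ fun k _ => hΦ.comp (hX k)]
  simp_rw [← lintegral_map hΦ (hX _)]
  rw [← lintegral_finsetSum_measure]
  exact lintegral_mono' hXμ le_rfl

theorem rpow_lintegral_sum_enorm_sq_le_eLpNorm (hX : ∀ k, Measurable (X k))
    (hXμ : ∑ k, m.map (X k) ≤ μ) (hf : Measurable f) :
    (∫⁻ ω, ∑ k, ‖f (X k ω)‖ₑ ^ (2 : ℝ) ∂m) ^ (1 / 2 : ℝ) ≤ eLpNorm f 2 μ := by
  rw [eLpNorm_eq_lintegral_rpow_enorm_toReal two_ne_zero ENNReal.ofNat_ne_top, ENNReal.toReal_ofNat]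
  gcongr
  exact lintegral_sum_comp_le hX hXμ (Φ := fun x => ‖f x‖ₑ ^ (2 : ℝ)) (by fun_prop)

theorem lintegral_sum_enorm_mul_enorm_le (hX : ∀ k, Measurable (X k)) (hY : ∀ k, Measurable (Y k))
    (hXμ : ∑ k, m.map (X k) ≤ μ) (hYμ : ∑ k, m.map (Y k) ≤ μ') (hf : Measurable f)
    (hg : Measurable g) :
    ∫⁻ ω, ∑ k, ‖f (X k ω)‖ₑ * ‖g (Y k ω)‖ₑ ∂m ≤ eLpNorm f 2 μ * eLpNorm g 2 μ' := by
  have hroot : ∀ x : ENNReal, (x ^ (1 / 2 : ℝ)) ^ (2 : ℝ) = x := fun x => by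
    rw [← ENNReal.rpow_mul]; norm_num
  calc ∫⁻ ω, ∑ k, ‖f (X k ω)‖ₑ * ‖g (Y k ω)‖ₑ ∂m
      ≤ ∫⁻ ω, (∑ k, ‖f (X k ω)‖ₑ ^ (2 : ℝ)) ^ (1 / 2 : ℝ) *
          (∑ k, ‖g (Y k ω)‖ₑ ^ (2 : ℝ)) ^ (1 / 2 : ℝ) ∂m :=
        lintegral_mono fun ω => ENNReal.inner_le_Lp_mul_Lq _ _ _ .two_two
    _ ≤ _ := ENNReal.lintegral_mul_le_Lp_mul_Lq m .two_two (by fun_prop) (by fun_prop)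
    _ ≤ _ := by
        simp only [hroot]
        gcongr
        · exact rpow_lintegral_sum_enorm_sq_le_eLpNorm hX hXμ hf
        · exact rpow_lintegral_sum_enorm_sq_le_eLpNorm hY hYμ hg

theorem lintegral_sum_enorm_mul_sub_mul_le (hX : ∀ k, Measurable (X k))
    (hY : ∀ k, Measurable (Y k)) (hXμ : ∑ k, m.map (X k) ≤ μ) (hYμ : ∑ k, m.map (Y k) ≤ μ')
    (hf : Measurable f) (hg : Measurable g) (hp : Measurable p) (hq : Measurable q) :
    ∫⁻ ω, ∑ k, ‖f (X k ω) * g (Y k ω) - p (X k ω) * q (Y k ω)‖ₑ ∂m ≤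
      eLpNorm (f - p) 2 μ * eLpNorm g 2 μ' + eLpNorm p 2 μ * eLpNorm (g - q) 2 μ' := by
  have hsplit : ∀ x y, ‖f x * g y - p x * q y‖ₑ ≤
      ‖(f - p) x‖ₑ * ‖g y‖ₑ + ‖p x‖ₑ * ‖(g - q) y‖ₑ := fun x y => by
    rw [← enorm_mul, ← enorm_mul]
    refine le_trans (le_of_eq ?_) (enorm_add_le _ _)
    simp only [Pi.sub_apply]
    ring_nf
  refine (lintegral_mono fun ω => Finset.sum_le_sum fun k _ => hsplit (X k ω) (Y k ω)).trans ?_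
  simp only [Finset.sum_add_distrib]
  rw [lintegral_add_left (by fun_prop)]
  exact add_le_add (lintegral_sum_enorm_mul_enorm_le hX hY hXμ hYμ (hf.sub hp) hg)
    (lintegral_sum_enorm_mul_enorm_le hX hY hXμ hYμ hp (hg.sub hq))

end SumCauchySchwarz

theorem exists_mem_trigPolynomials_mul_approx {ρ₁ ρ₂ : Measure ℝ} [IsFiniteMeasure ρ₁]
    [IsFiniteMeasure ρ₂] {f g : ℝ → ℝ} (hf : MemLp f 2 ρ₁) (hg : MemLp g 2 ρ₂) {ε : ENNReal}
    (hε : ε ≠ 0) : ∃ p ∈ trigPolynomials, ∃ q ∈ trigPolynomials,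
      eLpNorm (f - ⇑p) 2 ρ₁ * eLpNorm g 2 ρ₂ + eLpNorm p 2 ρ₁ * eLpNorm (g - ⇑q) 2 ρ₂ ≤ ε := by
  have happrox : ∀ {ρ : Measure ℝ} [IsFiniteMeasure ρ] {f : ℝ → ℝ}, MemLp f 2 ρ →
      ∀ {K : ENNReal}, K ≠ ⊤ → ∃ p ∈ trigPolynomials, K * eLpNorm (f - ⇑p) 2 ρ ≤ ε / 2 := by
    intro ρ _ f hf K hK
    obtain ⟨p, hp, hle⟩ := exists_mem_trigPolynomials_eLpNorm_sub_le hf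
      (ENNReal.div_pos (ENNReal.half_pos hε).ne' hK).ne'
    exact ⟨p, hp, (mul_le_mul_right hle K).trans ENNReal.mul_div_le⟩
  obtain ⟨p, hp, hfp⟩ := happrox hf hg.eLpNorm_ne_top
  obtain ⟨q, hq, hgq⟩ :=
    happrox hg (memLp_coe_boundedContinuousFunction (μ := ρ₁) p 2).eLpNorm_ne_top
  refine ⟨p, hp, q, hq, ?_⟩
  rw [mul_comm (eLpNorm (f - ⇑p) 2 ρ₁)]
  exact (add_le_add hfp hgq).trans_eq (ENNReal.add_halves ε)

section EmpiricalConvergence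

variable {Ω ι : Type*} [MeasurableSpace Ω] {P : Measure Ω} {l : Filter ι} {N : ι → ℕ}
  {u v : ∀ n, Ω → Fin (N n) → ℝ} {ρ ρ₁ ρ₂ : Measure ℝ} {G : Measure (ℝ × ℝ)}

theorem IsDominatedArray.mono (hu : IsDominatedArray P l u ρ₁) (hρ : ρ₁ ≤ ρ) :
    IsDominatedArray P l u ρ := by
  obtain ⟨E, hEm, hE, hle⟩ := hu
  exact ⟨E, hEm, hE, fun n => (hle n).trans (by gcongr)⟩

theorem IsDominatedArray.tendsto_measure_exists_mem (hu : IsDominatedArray P l u ρ)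
    (hum : ∀ n i, Measurable fun ω => u n ω i) {S : Set ℝ} (hS : ρ S = 0) :
    Tendsto (fun n => P {ω | ∃ i, u n ω i ∈ S}) l (𝓝 0) := by
  obtain ⟨E, hEm, hE, hle⟩ := hu
  refine tendsto_of_tendsto_of_tendsto_of_le_of_le tendsto_const_nhds hE (fun _ => zero_le)
    fun n => ?_
  have hnull : ∀ i, P (E n ∩ {ω | u n ω i ∈ S}) = 0 := fun i => by
    have hsum : (P.restrict (E n)).map (fun ω => u n ω i) S = 0 :=
      (Measure.absolutelyContinuous_of_le <| (Finset.single_le_sum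
        (f := fun i => (P.restrict (E n)).map fun ω => u n ω i) (fun _ _ => Measure.zero_le _)
        (Finset.mem_univ i)).trans (hle n)) (by simp [hS])
    have := Measure.preimage_null_of_map_null (hum n i).aemeasurable hsum
    rwa [Measure.restrict_apply' (hEm n), Set.inter_comm] at this
  have hsub : {ω | ∃ i, u n ω i ∈ S} ⊆ (E n)ᶜ ∪ ⋃ i, E n ∩ {ω | u n ω i ∈ S} := by
    rintro ω ⟨i, hi⟩
    by_cases hω : ω ∈ E n
    · exact .inr (Set.mem_iUnion.2 ⟨i, hω, hi⟩)
    · exact .inl hω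
  calc P {ω | ∃ i, u n ω i ∈ S} ≤ P (E n)ᶜ + P (⋃ i, E n ∩ {ω | u n ω i ∈ S}) :=
        (measure_mono hsub).trans (measure_union_le _ _)
    _ = P (E n)ᶜ := by rw [measure_iUnion_null hnull, add_zero]

theorem lintegral_enorm_average_mul_sub_le {A : Set Ω} (hum : ∀ n i, Measurable fun ω => u n ω i)
    (hvm : ∀ n i, Measurable fun ω => v n ω i) {n : ι}
    (hu : ∑ i, (P.restrict A).map (fun ω => u n ω i) ≤ (N n : ENNReal) • ρ₁)
    (hv : ∑ i, (P.restrict A).map (fun ω => v n ω i) ≤ (N n : ENNReal) • ρ₂) {f g p q : ℝ → ℝ}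
    (hf : Measurable f) (hg : Measurable g) (hp : Measurable p) (hq : Measurable q) :
    ∫⁻ ω in A, ‖(N n : ℝ)⁻¹ • ∑ i, f (u n ω i) * g (v n ω i) -
        (N n : ℝ)⁻¹ • ∑ i, p (u n ω i) * q (v n ω i)‖ₑ ∂P ≤
      eLpNorm (f - p) 2 ρ₁ * eLpNorm g 2 ρ₂ + eLpNorm p 2 ρ₁ * eLpNorm (g - q) 2 ρ₂ := by
  have hscale : ∀ {w : ∀ n, Ω → Fin (N n) → ℝ} {ρ : Measure ℝ},
      ∑ i, (P.restrict A).map (fun ω => w n ω i) ≤ (N n : ENNReal) • ρ →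
      ∑ i, ((N n : ENNReal)⁻¹ • P.restrict A).map (fun ω => w n ω i) ≤ ρ := fun {w ρ} hw => by
    simp_rw [Measure.map_smul, ← Finset.smul_sum]
    calc _ ≤ (N n : ENNReal)⁻¹ • (N n : ENNReal) • ρ := by gcongr
      _ ≤ (1 : ENNReal) • ρ := by rw [smul_smul]; gcongr; exact ENNReal.inv_mul_le_one _
      _ = ρ := one_smul _ _
  refine le_trans ?_ (lintegral_sum_enorm_mul_sub_mul_le (hum n) (hvm n) (hscale hu) (hscale hv)
    hf hg hp hq)
  rw [lintegral_smul_measure, smul_eq_mul, ← lintegral_const_mul _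
    (Finset.measurable_fun_sum _ fun i _ => by have := hum n i; have := hvm n i; fun_prop)]
  refine lintegral_mono fun ω => ?_
  rcases Nat.eq_zero_or_pos (N n) with hN | hN
  · simp [hN]
  · rw [← smul_sub, ← Finset.sum_sub_distrib, enorm_smul, enorm_inv (by positivity),
      Real.enorm_natCast]
    gcongr
    exact enorm_sum_le _ _

theorem enorm_integral_mul_sub_integral_mul_le (hG₁ : G.fst ≤ ρ₁) (hG₂ : G.snd ≤ ρ₂)
    {f g p q : ℝ → ℝ} (hf : Measurable f) (hg : Measurable g) (hp : Measurable p)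
    (hq : Measurable q) (hfg : Integrable (fun x => f x.1 * g x.2) G)
    (hpq : Integrable (fun x => p x.1 * q x.2) G) :
    ‖(∫ x, p x.1 * q x.2 ∂G) - ∫ x, f x.1 * g x.2 ∂G‖ₑ ≤
      eLpNorm (f - p) 2 ρ₁ * eLpNorm g 2 ρ₂ + eLpNorm p 2 ρ₁ * eLpNorm (g - q) 2 ρ₂ := by
  rw [← edist_eq_enorm_sub, edist_comm, edist_eq_enorm_sub, ← integral_sub hfg hpq]
  refine (enorm_integral_le_lintegral_enorm _).trans ?_
  simpa using lintegral_sum_enorm_mul_sub_mul_le (κ := Unit) (X := fun _ => Prod.fst)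
    (Y := fun _ => Prod.snd) (fun _ => measurable_fst) (fun _ => measurable_snd)
    (by simpa [Measure.fst] using hG₁) (by simpa [Measure.snd] using hG₂) hf hg hp hq

theorem cosWave_mul_cosWave (s t θ η x y : ℝ) : cosWave s θ x * cosWave t η y =
    2⁻¹ * (Real.cos (s * x + t * y + (θ + η)) + Real.cos (s * x + -t * y + (θ - η))) := by
  have hadd := Real.cos_add (s * x + θ) (t * y + η)
  have hsub := Real.cos_sub (s * x + θ) (t * y + η)
  rw [show s * x + t * y + (θ + η) = s * x + θ + (t * y + η) by ring,
    show s * x + -t * y + (θ - η) = s * x + θ - (t * y + η) by ring, hadd, hsub]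
  simp only [cosWave, BoundedContinuousFunction.coe_ofNormedAddCommGroup]
  ring

theorem tendstoInMeasure_average_cosWave_mul_cosWave [IsFiniteMeasure G]
    (hcos : ∀ s t θ, TendstoInMeasure P
      (fun n ω => (N n : ℝ)⁻¹ • ∑ i, Real.cos (s * u n ω i + t * v n ω i + θ)) l
      fun _ => ∫ x, Real.cos (s * x.1 + t * x.2 + θ) ∂G) (s t θ η : ℝ) :
    TendstoInMeasure P
      (fun n ω => (N n : ℝ)⁻¹ • ∑ i, cosWave s θ (u n ω i) * cosWave t η (v n ω i)) l
      fun _ => ∫ x, cosWave s θ x.1 * cosWave t η x.2 ∂G := by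
  have hcosint : ∀ s t θ, Integrable (fun x : ℝ × ℝ => Real.cos (s * x.1 + t * x.2 + θ)) G :=
    fun s t θ => .of_bound (Continuous.aestronglyMeasurable (by fun_prop)) 1
      (.of_forall fun x => Real.abs_cos_le_one _)
  simp only [cosWave_mul_cosWave, integral_const_mul,
    integral_add (hcosint s t _) (hcosint s (-t) _)]
  refine (tendstoInMeasure_comp_of_continuousAt (Φ := fun x => 2⁻¹ * x)
    (tendstoInMeasure_add_const (hcos s t (θ + η)) (hcos s (-t) (θ - η)))
    (by fun_prop)).congr_left fun n => .of_forall fun ω => ?_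
  simp only [← Finset.mul_sum, Finset.sum_add_distrib, smul_eq_mul]
  ring

theorem tendstoInMeasure_average_mul_of_mem_trigPolynomials [IsFiniteMeasure G]
    (hcos : ∀ s t θ, TendstoInMeasure P
      (fun n ω => (N n : ℝ)⁻¹ • ∑ i, Real.cos (s * u n ω i + t * v n ω i + θ)) l
      fun _ => ∫ x, Real.cos (s * x.1 + t * x.2 + θ) ∂G)
    {p q : BoundedContinuousFunction ℝ ℝ} (hp : p ∈ trigPolynomials) (hq : q ∈ trigPolynomials) :
    TendstoInMeasure P (fun n ω => (N n : ℝ)⁻¹ • ∑ i, p (u n ω i) * q (v n ω i)) l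
      fun _ => ∫ x, p x.1 * q x.2 ∂G := by
  have hint : ∀ p q : BoundedContinuousFunction ℝ ℝ, Integrable (fun x => p x.1 * q x.2) G :=
    fun p q => .of_bound (Continuous.aestronglyMeasurable (by fun_prop)) (‖p‖ * ‖q‖) <|
      .of_forall fun x => (norm_mul_le _ _).trans <|
        mul_le_mul (p.norm_coe_le_norm _) (q.norm_coe_le_norm _) (norm_nonneg _) (norm_nonneg _)
  induction hp, hq using Submodule.span_induction₂ with
  | mem_mem p q hp hq =>
    obtain ⟨⟨⟨s, θ⟩, rfl⟩, ⟨t, η⟩, rfl⟩ := hp, hq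
    exact tendstoInMeasure_average_cosWave_mul_cosWave hcos s t θ η
  | zero_left q hq => simpa using tendstoInMeasure_const (P := P) (l := l) (0 : ℝ)
  | zero_right p hp => simpa using tendstoInMeasure_const (P := P) (l := l) (0 : ℝ)
  | add_left p p' q _ _ _ h h' =>
    simpa [add_mul, Finset.sum_add_distrib, mul_add, integral_add (hint _ _) (hint _ _)] using
      tendstoInMeasure_add_const h h'
  | add_right p q q' _ _ _ h h' =>
    simpa [mul_add, Finset.sum_add_distrib, integral_add (hint _ _) (hint _ _)] using
      tendstoInMeasure_add_const h h'
  | smul_left c p q _ _ h =>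
    simpa [mul_assoc, mul_left_comm, ← Finset.mul_sum, integral_const_mul] using
      tendstoInMeasure_comp_of_continuousAt (Φ := fun x => c * x) h (by fun_prop)
  | smul_right c p q _ _ h =>
    simpa [mul_left_comm, ← Finset.mul_sum, integral_const_mul] using
      tendstoInMeasure_comp_of_continuousAt (Φ := fun x => c * x) h (by fun_prop)

theorem sum_map_restrict_le_of_subset {κ : Type*} [Fintype κ] {X : κ → Ω → ℝ} {A B : Set Ω}
    (hAB : A ⊆ B) (hX : ∀ k, Measurable (X k)) (hle : ∑ k, (P.restrict B).map (X k) ≤ ρ) :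
    ∑ k, (P.restrict A).map (X k) ≤ ρ :=
  (Finset.sum_le_sum fun k _ =>
    Measure.map_mono (Measure.restrict_mono_set P hAB) (hX k)).trans hle

theorem integrable_mul_of_memLp_two (hG₁ : G.fst ≤ ρ₁) (hG₂ : G.snd ≤ ρ₂) {f g : ℝ → ℝ}
    (hf : MemLp f 2 ρ₁) (hg : MemLp g 2 ρ₂) : Integrable (fun x => f x.1 * g x.2) G :=
  ((hf.mono_measure hG₁).comp_of_map measurable_fst.aemeasurable).integrable_mul
    ((hg.mono_measure hG₂).comp_of_map measurable_snd.aemeasurable)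

theorem tendstoInMeasure_average_mul_of_isDominatedArray [IsFiniteMeasure ρ₁] [IsFiniteMeasure ρ₂]
    (hum : ∀ n i, Measurable fun ω => u n ω i) (hvm : ∀ n i, Measurable fun ω => v n ω i)
    (hu : IsDominatedArray P l u ρ₁) (hv : IsDominatedArray P l v ρ₂) (hG₁ : G.fst ≤ ρ₁)
    (hG₂ : G.snd ≤ ρ₂)
    (hcos : ∀ s t θ, TendstoInMeasure P
      (fun n ω => (N n : ℝ)⁻¹ • ∑ i, Real.cos (s * u n ω i + t * v n ω i + θ)) l
      fun _ => ∫ x, Real.cos (s * x.1 + t * x.2 + θ) ∂G)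
    {f g : ℝ → ℝ} (hf : Measurable f) (hg : Measurable g) (hfL : MemLp f 2 ρ₁)
    (hgL : MemLp g 2 ρ₂) :
    TendstoInMeasure P (fun n ω => (N n : ℝ)⁻¹ • ∑ i, f (u n ω i) * g (v n ω i)) l
      fun _ => ∫ x, f x.1 * g x.2 ∂G := by
  obtain ⟨E, hEm, hE, hEle⟩ := hu
  obtain ⟨E', hEm', hE', hEle'⟩ := hv
  have : IsFiniteMeasure G :=
    ⟨Measure.fst_univ (ρ := G) ▸ (hG₁ _).trans_lt (measure_lt_top ρ₁ _)⟩
  refine tendstoInMeasure_const_of_approx (A := fun n => E n ∩ E' n)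
    (fun n => (hEm n).inter (hEm' n)) ?_ fun ε hε => ?_
  · refine tendsto_of_tendsto_of_tendsto_of_le_of_le tendsto_const_nhds
      (by simpa using hE.add hE') (fun _ => zero_le) fun n => ?_
    rw [Set.compl_inter]
    exact measure_union_le _ _
  · obtain ⟨p, hp, q, hq, hpq⟩ := exists_mem_trigPolynomials_mul_approx hfL hgL hε
    have hpm : Measurable p := p.continuous.measurable
    have hqm : Measurable q := q.continuous.measurable
    refine ⟨_, _, fun n => ?_, tendstoInMeasure_average_mul_of_mem_trigPolynomials hcos hp hq,
      (enorm_integral_mul_sub_integral_mul_le hG₁ hG₂ hf hg hpm hqm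
        (integrable_mul_of_memLp_two hG₁ hG₂ hfL hgL)
        (integrable_mul_of_memLp_two hG₁ hG₂ (memLp_coe_boundedContinuousFunction p 2)
          (memLp_coe_boundedContinuousFunction q 2))).trans hpq,
      .of_forall fun n => (lintegral_enorm_average_mul_sub_le hum hvm
        (sum_map_restrict_le_of_subset Set.inter_subset_left (hum n) (hEle n))
        (sum_map_restrict_le_of_subset Set.inter_subset_right (hvm n) (hEle' n)) hf hg hpm
        hqm).trans hpq⟩
    have := hum n
    have := hvm n
    fun_prop

end EmpiricalConvergence

section GaussianPair

/-- The variance of `s X + t Y` for centred `X`, `Y` with variances `q₁₁`, `q₂₂` and covariance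
`q₁₂`. -/
def covForm (q₁₁ q₁₂ q₂₂ s t : ℝ) : ℝ := s ^ 2 * q₁₁ + 2 * (s * t) * q₁₂ + t ^ 2 * q₂₂

/-- The joint law of the Gaussian pair `(u₁, u₂)` of the covariance map. -/
noncomputable def gaussianPair (q₁₁ q₁₂ q₂₂ : ℝ) : Measure (ℝ × ℝ) :=
  (stdGaussian1.prod stdGaussian1).map
    fun z => (gaussU₁ q₁₁ z, gaussU₂ q₂₂ (corr q₁₂ q₁₁ q₂₂) z)

variable {q₁₁ q₁₂ q₂₂ : ℝ}

theorem covForm_const_mul (c s t : ℝ) :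
    covForm (c * q₁₁) (c * q₁₂) (c * q₂₂) s t = c * covForm q₁₁ q₁₂ q₂₂ s t := by
  simp only [covForm]
  ring

theorem nonneg_left_of_covForm_nonneg (h : ∀ s t, 0 ≤ covForm q₁₁ q₁₂ q₂₂ s t) : 0 ≤ q₁₁ := by
  simpa [covForm] using h 1 0

theorem nonneg_right_of_covForm_nonneg (h : ∀ s t, 0 ≤ covForm q₁₁ q₁₂ q₂₂ s t) : 0 ≤ q₂₂ := by
  simpa [covForm] using h 0 1

theorem sq_le_mul_of_covForm_nonneg (h : ∀ s t, 0 ≤ covForm q₁₁ q₁₂ q₂₂ s t) :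
    q₁₂ ^ 2 ≤ q₁₁ * q₂₂ := by
  have hdiscrim := discrim_le_zero (a := q₁₁) (b := 2 * q₁₂) (c := q₂₂) fun s => by
    have := h s 1
    simp only [covForm] at this
    linarith
  simp only [discrim] at hdiscrim
  linarith

theorem abs_corr_le_one (h : q₁₂ ^ 2 ≤ q₁₁ * q₂₂) : |corr q₁₂ q₁₁ q₂₂| ≤ 1 := by
  rw [corr, abs_div, abs_of_nonneg (Real.sqrt_nonneg _)]
  exact div_le_one_of_le₀ (Real.abs_le_sqrt h) (Real.sqrt_nonneg _)

theorem sqrt_mul_sqrt_mul_corr (h₁ : 0 ≤ q₁₁) (h : q₁₂ ^ 2 ≤ q₁₁ * q₂₂) :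
    √q₁₁ * √q₂₂ * corr q₁₂ q₁₁ q₂₂ = q₁₂ := by
  rw [← Real.sqrt_mul h₁, corr]
  rcases eq_or_ne √(q₁₁ * q₂₂) 0 with h0 | h0
  · have hzero := Real.abs_le_sqrt h
    rw [h0] at hzero
    rw [h0, zero_mul]
    exact (abs_nonpos_iff.1 hzero).symm
  · field_simp

theorem map_stdGaussian1_prod_linear (α β : ℝ) :
    (stdGaussian1.prod stdGaussian1).map (fun z => α * z.1 + β * z.2) =
      gaussianReal 0 (α ^ 2 + β ^ 2).toNNReal := by
  have hα := gaussianReal_const_mul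
    (measurePreserving_fst (μ := stdGaussian1) (ν := stdGaussian1)).hasLaw α
  have hβ := gaussianReal_const_mul
    (measurePreserving_snd (μ := stdGaussian1) (ν := stdGaussian1)).hasLaw β
  have hsum := gaussianReal_add_gaussianReal_of_indepFun (indepFun_prod (X := fun x => α * x)
    (Y := fun x => β * x) (by fun_prop) (by fun_prop)) hα.map_eq hβ.map_eq
  rw [Real.toNNReal_add (sq_nonneg _) (sq_nonneg _), Real.toNNReal_of_nonneg (sq_nonneg α),
    Real.toNNReal_of_nonneg (sq_nonneg β)]
  simp only [mul_zero, mul_one, add_zero] at hsum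
  exact hsum

theorem measurable_gaussU_prodMk (q₁₁ q₂₂ c : ℝ) :
    Measurable fun z => (gaussU₁ q₁₁ z, gaussU₂ q₂₂ c z) := by
  unfold gaussU₁ gaussU₂
  fun_prop

theorem map_linear_gaussianPair (h : ∀ s t, 0 ≤ covForm q₁₁ q₁₂ q₂₂ s t) (s t : ℝ) :
    (gaussianPair q₁₁ q₁₂ q₂₂).map (fun x => s * x.1 + t * x.2) =
      gaussianReal 0 (covForm q₁₁ q₁₂ q₂₂ s t).toNNReal := by
  have h₁ := nonneg_left_of_covForm_nonneg h
  have h₂ := nonneg_right_of_covForm_nonneg h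
  have hsq := sq_le_mul_of_covForm_nonneg h
  set c := corr q₁₂ q₁₁ q₂₂ with hc
  have hcorr : √q₁₁ * √q₂₂ * c = q₁₂ := sqrt_mul_sqrt_mul_corr h₁ hsq
  have hc1 : 0 ≤ 1 - c ^ 2 :=
    sub_nonneg.2 ((sq_le_one_iff_abs_le_one c).2 (abs_corr_le_one hsq))
  have hvar : covForm q₁₁ q₁₂ q₂₂ s t =
      (s * √q₁₁ + t * (√q₂₂ * c)) ^ 2 + (t * (√q₂₂ * √(1 - c ^ 2))) ^ 2 := by
    rw [covForm, ← hcorr]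
    linear_combination -s ^ 2 * Real.sq_sqrt h₁ - t ^ 2 * Real.sq_sqrt h₂ -
      (t * √q₂₂) ^ 2 * Real.sq_sqrt hc1
  rw [hvar, ← map_stdGaussian1_prod_linear, gaussianPair,
    Measure.map_map (by fun_prop) (measurable_gaussU_prodMk _ _ _)]
  congr 1
  ext z
  simp only [Function.comp_apply, gaussU₁, gaussU₂, ← hc]
  ring

theorem fst_gaussianPair (h : ∀ s t, 0 ≤ covForm q₁₁ q₁₂ q₂₂ s t) :
    (gaussianPair q₁₁ q₁₂ q₂₂).fst = gaussianReal 0 q₁₁.toNNReal := by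
  simpa [covForm, Measure.fst] using map_linear_gaussianPair h 1 0

theorem snd_gaussianPair (h : ∀ s t, 0 ≤ covForm q₁₁ q₁₂ q₂₂ s t) :
    (gaussianPair q₁₁ q₁₂ q₂₂).snd = gaussianReal 0 q₂₂.toNNReal := by
  simpa [covForm, Measure.snd] using map_linear_gaussianPair h 0 1

theorem integral_cos_gaussianPair (h : ∀ s t, 0 ≤ covForm q₁₁ q₁₂ q₂₂ s t) (s t θ : ℝ) :
    ∫ x, Real.cos (s * x.1 + t * x.2 + θ) ∂gaussianPair q₁₁ q₁₂ q₂₂ =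
      Real.exp (-(covForm q₁₁ q₁₂ q₂₂ s t / 2)) * Real.cos θ := by
  have hlaw := integral_cos_add_gaussianReal (covForm q₁₁ q₁₂ q₂₂ s t).toNNReal θ
  rwa [← map_linear_gaussianPair h, integral_map (by fun_prop) (by fun_prop),
    Real.coe_toNNReal _ (h s t)] at hlaw

theorem integrable_sq_linear_gaussianPair (h : ∀ s t, 0 ≤ covForm q₁₁ q₁₂ q₂₂ s t) (s t : ℝ) :
    Integrable (fun x => (s * x.1 + t * x.2) ^ 2) (gaussianPair q₁₁ q₁₂ q₂₂) := by
  have hid := (IsGaussian.memLp_id (gaussianReal 0 (covForm q₁₁ q₁₂ q₂₂ s t).toNNReal) 2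
    ENNReal.ofNat_ne_top).integrable_sq
  rw [← map_linear_gaussianPair h] at hid
  exact hid.comp_measurable (by fun_prop)

theorem integral_sq_linear_gaussianPair (h : ∀ s t, 0 ≤ covForm q₁₁ q₁₂ q₂₂ s t) (s t : ℝ) :
    ∫ x, (s * x.1 + t * x.2) ^ 2 ∂gaussianPair q₁₁ q₁₂ q₂₂ = covForm q₁₁ q₁₂ q₂₂ s t := by
  have hvar := variance_fun_id_gaussianReal (μ := 0) (v := (covForm q₁₁ q₁₂ q₂₂ s t).toNNReal)
  rwa [variance_of_integral_eq_zero (by fun_prop) integral_id_gaussianReal,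
    ← map_linear_gaussianPair h, integral_map (by fun_prop) (by fun_prop),
    Real.coe_toNNReal _ (h s t)] at hvar

theorem integral_fst_mul_snd_gaussianPair (h : ∀ s t, 0 ≤ covForm q₁₁ q₁₂ q₂₂ s t) :
    ∫ x, x.1 * x.2 ∂gaussianPair q₁₁ q₁₂ q₂₂ = q₁₂ := by
  have hint := integrable_sq_linear_gaussianPair h
  have hval := integral_sq_linear_gaussianPair h
  have hpolar : ∀ x : ℝ × ℝ, x.1 * x.2 =
      ((1 * x.1 + 1 * x.2) ^ 2 - (1 * x.1 + 0 * x.2) ^ 2 - (0 * x.1 + 1 * x.2) ^ 2) / 2 :=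
    fun x => by ring
  simp only [hpolar]
  have hsub : Integrable (fun x => (1 * x.1 + 1 * x.2) ^ 2 - (1 * x.1 + 0 * x.2) ^ 2)
      (gaussianPair q₁₁ q₁₂ q₂₂) := (hint 1 1).sub (hint 1 0)
  rw [integral_div, integral_sub hsub (hint 0 1), integral_sub (hint 1 1) (hint 1 0), hval, hval,
    hval]
  simp only [covForm]
  ring

theorem integral_mul_gaussianPair {φ ψ : ℝ → ℝ} (hφ : Measurable φ) (hψ : Measurable ψ) :
    ∫ x, φ x.1 * ψ x.2 ∂gaussianPair q₁₁ q₁₂ q₂₂ =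
      ∫ z, φ (gaussU₁ q₁₁ z) * ψ (gaussU₂ q₂₂ (corr q₁₂ q₁₁ q₂₂) z)
        ∂(stdGaussian1.prod stdGaussian1) :=
  integral_map (measurable_gaussU_prodMk _ _ _).aemeasurable (by fun_prop)

theorem map_sqrt_mul_stdGaussian1 (v : NNReal) :
    stdGaussian1.map (√v * ·) = gaussianReal 0 v := by
  rw [gaussianReal_map_const_mul, mul_zero]
  congr 1
  ext
  simp

theorem memLp_two_gaussianReal_of_integrable_sq {φ : ℝ → ℝ} (hφ : Measurable φ)
    (hφ2 : ∀ s, Integrable (fun z => φ (s * z) ^ 2) stdGaussian1) (v : NNReal) :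
    MemLp φ 2 (gaussianReal 0 v) := by
  rw [← map_sqrt_mul_stdGaussian1, memLp_map_measure_iff (by fun_prop) (by fun_prop)]
  exact (memLp_two_iff_integrable_sq
    (hφ.comp (measurable_const.mul measurable_id)).aestronglyMeasurable).2 (hφ2 √v)

theorem integrable_mul_gaussU {φ : ℝ → ℝ} (hφ : Measurable φ)
    (hφL : ∀ v, MemLp φ 2 (gaussianReal 0 v)) (h : ∀ s t, 0 ≤ covForm q₁₁ q₁₂ q₂₂ s t) :
    Integrable (fun z => φ (gaussU₁ q₁₁ z) * φ (gaussU₂ q₂₂ (corr q₁₂ q₁₁ q₂₂) z))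
      (stdGaussian1.prod stdGaussian1) :=
  (integrable_map_measure (by fun_prop) (measurable_gaussU_prodMk _ _ _).aemeasurable).1
    (integrable_mul_of_memLp_two (fst_gaussianPair h).le (snd_gaussianPair h).le (hφL _) (hφL _))

theorem gaussU₂_corr_self {q : ℝ} (hq : 0 ≤ q) (z : ℝ × ℝ) :
    gaussU₂ q (corr q q q) z = √q * z.1 := by
  rcases hq.eq_or_lt with rfl | h
  · simp [gaussU₂]
  · simp [gaussU₂, corr, Real.sqrt_mul_self hq, h.ne']

theorem integral_mul_gaussianPair_self {φ : ℝ → ℝ} (hφ : Measurable φ) {q : ℝ} (hq : 0 ≤ q) :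
    ∫ x, φ x.1 * φ x.2 ∂gaussianPair q q q = ∫ z, φ (√q * z) ^ 2 ∂stdGaussian1 := by
  simp only [integral_mul_gaussianPair hφ hφ, gaussU₂_corr_self hq, gaussU₁, ← sq]
  rw [integral_fun_fst fun z => φ (√q * z) ^ 2, probReal_univ, one_smul]

theorem gaussianReal_absolutelyContinuous_gaussianReal {μ : ℝ} {v w : NNReal}
    (h : v = 0 ↔ w = 0) : gaussianReal μ v ≪ gaussianReal μ w := by
  rcases eq_or_ne v 0 with hv | hv
  · rw [hv, h.1 hv]
  · exact (gaussianReal_absolutelyContinuous μ hv).trans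
      (gaussianReal_absolutelyContinuous' μ (mt h.2 hv))

theorem ae_eq_zero_of_integral_mul_gaussianPair_self_eq_zero {φ : ℝ → ℝ} (hφ : Measurable φ)
    (hφL : ∀ v, MemLp φ 2 (gaussianReal 0 v)) {q : ℝ} (hq : 0 ≤ q)
    (h : ∫ x, φ x.1 * φ x.2 ∂gaussianPair q q q = 0) :
    φ =ᵐ[gaussianReal 0 q.toNNReal] 0 := by
  rw [integral_mul_gaussianPair_self hφ hq, ← Real.coe_toNNReal q hq,
    ← integral_map (f := fun y => φ y ^ 2) (by fun_prop) (by fun_prop),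
    map_sqrt_mul_stdGaussian1,
    integral_eq_zero_iff_of_nonneg (fun y => sq_nonneg (φ y)) (hφL _).integrable_sq] at h
  exact h.mono fun y hy => eq_zero_of_pow_eq_zero hy

end GaussianPair

theorem memLp_two_add_measure {α : Type*} [MeasurableSpace α] {μ ν : Measure α} {f : α → ℝ}
    (hμ : MemLp f 2 μ) (hν : MemLp f 2 ν) : MemLp f 2 (μ + ν) :=
  (memLp_two_iff_integrable_sq (hμ.1.add_measure hν.1)).2
    (hμ.integrable_sq.add_measure hν.integrable_sq)

section LayerLimit

variable {Ω ι κ : Type*} [MeasurableSpace Ω] {P : Measure Ω} {l : Filter ι} {m : ι → ℕ}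
  {va vb : ι → NNReal} {p : ∀ n, Ω → κ → (Fin (m n) → ℝ) × ℝ} {V : κ → κ → ℝ}

/-- The inputs `p n · a` of a sequence of random layers have the limiting covariances `V`. When
`V a a = 0`, convergence in probability of the variance to `0` is not enough to control a
discontinuous activation, so the variance is required to vanish with probability tending to `1`. -/
structure HasLimitCov (P : Measure Ω) (l : Filter ι) (va vb : ι → NNReal)
    (p : ∀ n, Ω → κ → (Fin (m n) → ℝ) × ℝ) (V : κ → κ → ℝ) : Prop where
  tendstoInMeasure : ∀ a b, TendstoInMeasure P
    (fun n ω => inputCov (va n) (vb n) (p n ω a) (p n ω b)) l fun _ => V a b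
  tendsto_measure_ne_zero : ∀ a, V a a = 0 →
    Tendsto (fun n => P {ω | inputCov (va n) (vb n) (p n ω a) (p n ω a) ≠ 0}) l (𝓝 0)

theorem hasLimitCov_const {m : ℕ} (va vb : NNReal) (p : κ → (Fin m → ℝ) × ℝ) :
    HasLimitCov P l (fun _ => va) (fun _ => vb) (fun _ _ => p)
      fun a b => inputCov va vb (p a) (p b) where
  tendstoInMeasure _ _ := tendstoInMeasure_const _
  tendsto_measure_ne_zero a ha := by simp [ha, tendsto_const_nhds]

namespace HasLimitCov

theorem tendstoInMeasure_comb (hV : HasLimitCov P l va vb p V) (a b : κ) (s t : ℝ) :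
    TendstoInMeasure P (fun n ω => inputCov (va n) (vb n) (s • p n ω a + t • p n ω b)
      (s • p n ω a + t • p n ω b)) l fun _ => covForm (V a a) (V a b) (V b b) s t := by
  have hmul := fun (c : ℝ) a b => tendstoInMeasure_comp_of_continuousAt (Φ := (c * ·))
    (hV.tendstoInMeasure a b) (continuous_const_mul c).continuousAt
  simp only [inputCov_comb_self]
  exact tendstoInMeasure_add_const
    (tendstoInMeasure_add_const (hmul (s ^ 2) a a) (hmul (2 * (s * t)) a b)) (hmul (t ^ 2) b b)

theorem covForm_nonneg [l.NeBot] [NeZero P] (hV : HasLimitCov P l va vb p V) (a b : κ) (s t : ℝ) :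
    0 ≤ covForm (V a a) (V a b) (V b b) s t :=
  mem_of_tendstoInMeasure_const isClosed_Ici (hV.tendstoInMeasure_comb a b s t)
    fun _ _ => inputCov_self_nonneg _

theorem covForm_const_mul_nonneg [l.NeBot] [NeZero P] (hV : HasLimitCov P l va vb p V) {γ : ℝ}
    (hγ : 0 ≤ γ) (a b : κ) (s t : ℝ) :
    0 ≤ covForm (γ * V a a) (γ * V a b) (γ * V b b) s t := by
  rw [covForm_const_mul]
  exact mul_nonneg hγ (hV.covForm_nonneg a b s t)

theorem nonneg [l.NeBot] [NeZero P] (hV : HasLimitCov P l va vb p V) (a : κ) : 0 ≤ V a a :=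
  nonneg_left_of_covForm_nonneg (hV.covForm_nonneg a a)

theorem tendsto_measure_notMem_Icc [l.NeBot] [NeZero P] (hV : HasLimitCov P l va vb p V) (a : κ) :
    Tendsto (fun n => P {ω | inputCov (va n) (vb n) (p n ω a) (p n ω a) ∉
      Set.Icc (V a a / 2) (2 * V a a)}) l (𝓝 0) := by
  rcases (hV.nonneg a).eq_or_lt with h0 | hpos
  · simpa [← h0] using hV.tendsto_measure_ne_zero a h0.symm
  · exact tendstoInMeasure_const_iff.1 (hV.tendstoInMeasure a a) _
      (Icc_mem_nhds (by linarith) (by linarith))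

variable [IsProbabilityMeasure P] {γ : ℝ} {N r : ι → ℕ}
  {C : ∀ n, Ω → Matrix (Fin (N n)) (Fin (r n)) ℝ}
  {A : ∀ n, Ω → Matrix (Fin (r n)) (Fin (m n)) ℝ} {b : ∀ n, Ω → Fin (r n) → ℝ}

theorem tendstoInMeasure_average_cos_layerMap [l.IsCountablyGenerated]
    (hV : HasLimitCov P l va vb p V)
    (h : ∀ n, IsRandomLowRankLayer P (va n) (vb n) (C n) (A n) (b n)) (hN : Tendsto N l atTop)
    (hr : Tendsto (fun n => (r n : ℝ) / N n) l (𝓝 γ)) (hp : ∀ n, Measurable (p n))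
    (hind : ∀ n, IndepFun (p n) (fun ω => (C n ω, A n ω, b n ω)) P) (a a' : κ) (s t θ : ℝ) :
    TendstoInMeasure P (fun n ω => (N n : ℝ)⁻¹ • ∑ i,
      Real.cos (s * layerMap (C n ω) (A n ω) (b n ω) (p n ω a) i +
        t * layerMap (C n ω) (A n ω) (b n ω) (p n ω a') i + θ)) l
      fun _ => Real.exp (-(γ * covForm (V a a) (V a a') (V a' a') s t / 2)) * Real.cos θ := by
  have hcomb : ∀ n, Measurable fun q : κ → (Fin (m n) → ℝ) × ℝ => s • q a + t • q a' :=
    fun n => by fun_prop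
  have hexp := tendstoInMeasure_average_cexp_layerMap h hN hr (fun n => (hcomb n).comp (hp n))
    (fun n => (hind n).comp (hcomb n) measurable_id) (hV.tendstoInMeasure_comb a a' s t)
  have hre := tendstoInMeasure_comp_of_continuousAt
    (Φ := fun z : ℂ => (Complex.exp (θ * Complex.I) * z).re) hexp
    (Continuous.continuousAt (by fun_prop))
  refine (hre.congr_left fun n => .of_forall fun ω => ?_).congr_right (.of_forall fun ω => ?_)
  · simp only [Function.comp_apply, layerMap_comb, mul_smul_comm, Finset.mul_sum, Complex.smul_re,
      Complex.re_sum, ← Complex.exp_add, ← add_mul, ← Complex.ofReal_add,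
      Complex.exp_ofReal_mul_I_re, Pi.add_apply, Pi.smul_apply, smul_eq_mul, add_comm θ]
  · rw [Complex.re_mul_ofReal, Complex.exp_ofReal_mul_I_re, mul_comm]

theorem isDominatedArray_layerMap [l.NeBot] (hV : HasLimitCov P l va vb p V)
    (h : ∀ n, IsRandomLowRankLayer P (va n) (vb n) (C n) (A n) (b n)) (hγ : 0 < γ)
    (hN : Tendsto N l atTop) (hr : Tendsto (fun n => (r n : ℝ) / N n) l (𝓝 γ))
    (hp : ∀ n, Measurable (p n)) (hind : ∀ n, IndepFun (p n) (fun ω => (C n ω, A n ω, b n ω)) P)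
    (a : κ) :
    ∃ K : ENNReal, K ≠ ⊤ ∧ IsDominatedArray P l
      (fun n ω => layerMap (C n ω) (A n ω) (b n ω) (p n ω a))
      (K • gaussianReal 0 (2 * V a a).toNNReal) :=
  exists_isDominatedArray_layerMap h hγ hN hr (fun n => (measurable_pi_apply a).comp (hp n))
    (fun n => (hind n).comp (measurable_pi_apply a) measurable_id) (hV.tendsto_measure_notMem_Icc a)

theorem tendstoInMeasure_average_mul_layerMap [l.NeBot] [l.IsCountablyGenerated]
    (hV : HasLimitCov P l va vb p V)
    (h : ∀ n, IsRandomLowRankLayer P (va n) (vb n) (C n) (A n) (b n)) (hγ : 0 < γ)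
    (hN : Tendsto N l atTop) (hr : Tendsto (fun n => (r n : ℝ) / N n) l (𝓝 γ))
    (hp : ∀ n, Measurable (p n)) (hind : ∀ n, IndepFun (p n) (fun ω => (C n ω, A n ω, b n ω)) P)
    {f g : ℝ → ℝ} (hf : Measurable f) (hg : Measurable g)
    (hfL : ∀ v, MemLp f 2 (gaussianReal 0 v)) (hgL : ∀ v, MemLp g 2 (gaussianReal 0 v))
    (a a' : κ) :
    TendstoInMeasure P (fun n ω => (N n : ℝ)⁻¹ • ∑ i,
      f (layerMap (C n ω) (A n ω) (b n ω) (p n ω a) i) *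
        g (layerMap (C n ω) (A n ω) (b n ω) (p n ω a') i)) l
      fun _ => ∫ x, f x.1 * g x.2
        ∂gaussianPair (γ * V a a) (γ * V a a') (γ * V a' a') := by
  have hnonneg := hV.covForm_const_mul_nonneg hγ.le a a'
  have hmeas := fun a n => (h n).measurable_layerMap_apply ((measurable_pi_apply a).comp (hp n))
  obtain ⟨K, hK, hu⟩ := hV.isDominatedArray_layerMap h hγ hN hr hp hind a
  obtain ⟨K', hK', hv⟩ := hV.isDominatedArray_layerMap h hγ hN hr hp hind a'
  have := Measure.smul_finite (gaussianReal 0 (2 * V a a).toNNReal) hK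
  have := Measure.smul_finite (gaussianReal 0 (2 * V a' a').toNNReal) hK'
  refine tendstoInMeasure_average_mul_of_isDominatedArray (hmeas a) (hmeas a')
    (hu.mono (Measure.le_add_right le_rfl)) (hv.mono (Measure.le_add_right le_rfl))
    ((fst_gaussianPair hnonneg).trans_le (Measure.le_add_left le_rfl))
    ((snd_gaussianPair hnonneg).trans_le (Measure.le_add_left le_rfl))
    (fun s t θ => ?_) hf hg
    (memLp_two_add_measure ((hfL _).smul_measure hK) (hfL _))
    (memLp_two_add_measure ((hgL _).smul_measure hK') (hgL _))
  rw [integral_cos_gaussianPair hnonneg, covForm_const_mul]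
  exact hV.tendstoInMeasure_average_cos_layerMap h hN hr hp hind a a' s t θ

end HasLimitCov

end LayerLimit

section ActivationLimit

variable {Ω ι κ : Type*} [MeasurableSpace Ω] {P : Measure Ω} [IsProbabilityMeasure P]
  {l : Filter ι} [l.NeBot] {m : ι → ℕ} {va vb : ι → NNReal}
  {p : ∀ n, Ω → κ → (Fin (m n) → ℝ) × ℝ} {V : κ → κ → ℝ} {γ : ℝ} {N r : ι → ℕ}
  {C : ∀ n, Ω → Matrix (Fin (N n)) (Fin (r n)) ℝ}
  {A : ∀ n, Ω → Matrix (Fin (r n)) (Fin (m n)) ℝ} {b : ∀ n, Ω → Fin (r n) → ℝ} {φ : ℝ → ℝ}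

namespace HasLimitCov

theorem tendsto_measure_exists_activation_ne_zero (hV : HasLimitCov P l va vb p V)
    (h : ∀ n, IsRandomLowRankLayer P (va n) (vb n) (C n) (A n) (b n)) (hγ : 0 < γ)
    (hN : Tendsto N l atTop) (hr : Tendsto (fun n => (r n : ℝ) / N n) l (𝓝 γ))
    (hp : ∀ n, Measurable (p n)) (hind : ∀ n, IndepFun (p n) (fun ω => (C n ω, A n ω, b n ω)) P)
    {a : κ} (hφ : φ =ᵐ[gaussianReal 0 (γ * V a a).toNNReal] 0) :
    Tendsto (fun n => P {ω | ∃ i, φ (layerMap (C n ω) (A n ω) (b n ω) (p n ω a) i) ≠ 0})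
      l (𝓝 0) := by
  obtain ⟨K, -, hdom⟩ := hV.isDominatedArray_layerMap h hγ hN hr hp hind a
  have hmeas := fun n => (h n).measurable_layerMap_apply ((measurable_pi_apply a).comp (hp n))
  have hac : gaussianReal 0 (2 * V a a).toNNReal ≪ gaussianReal 0 (γ * V a a).toNNReal :=
    gaussianReal_absolutelyContinuous_gaussianReal <| by
      simp only [Real.toNNReal_eq_zero, mul_nonpos_iff_pos_imp_nonpos, hγ, hγ.le,
        zero_lt_two, zero_le_two]
  exact hdom.tendsto_measure_exists_mem hmeas (S := {y | φ y ≠ 0})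
    ((Measure.smul_absolutelyContinuous.trans hac) hφ)

theorem inputCov_activation {N : ℕ} (α β : NNReal) (u v : Fin N → ℝ) :
    inputCov (α / N) β (fun i => φ (u i), 1) (fun i => φ (v i), 1) =
      α * ((N : ℝ)⁻¹ • ∑ i, φ (u i) * φ (v i)) + β := by
  simp only [inputCov, dotProduct, NNReal.coe_div, NNReal.coe_natCast, smul_eq_mul]
  ring

theorem activation [l.IsCountablyGenerated] (hV : HasLimitCov P l va vb p V)
    (h : ∀ n, IsRandomLowRankLayer P (va n) (vb n) (C n) (A n) (b n)) (hγ : 0 < γ)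
    (hN : Tendsto N l atTop) (hr : Tendsto (fun n => (r n : ℝ) / N n) l (𝓝 γ))
    (hp : ∀ n, Measurable (p n)) (hind : ∀ n, IndepFun (p n) (fun ω => (C n ω, A n ω, b n ω)) P)
    (hφ : Measurable φ) (hφL : ∀ v, MemLp φ 2 (gaussianReal 0 v)) (α β : NNReal) :
    HasLimitCov P l (fun n => α / N n) (fun _ => β)
      (fun n ω a => (fun i => φ (layerMap (C n ω) (A n ω) (b n ω) (p n ω a) i), 1))
      (fun a a' => α * (∫ x, φ x.1 * φ x.2
        ∂gaussianPair (γ * V a a) (γ * V a a') (γ * V a' a')) + β) where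
  tendstoInMeasure a a' := by
    simp only [inputCov_activation]
    exact tendstoInMeasure_comp_of_continuousAt (Φ := fun y => (α : ℝ) * y + β)
      (hV.tendstoInMeasure_average_mul_layerMap h hγ hN hr hp hind hφ hφ hφL hφL a a')
      (Continuous.continuousAt (by fun_prop))
  tendsto_measure_ne_zero a hzero := by
    have hq : 0 ≤ γ * V a a := mul_nonneg hγ.le (hV.nonneg a)
    have hint : 0 ≤ ∫ x, φ x.1 * φ x.2 ∂gaussianPair (γ * V a a) (γ * V a a) (γ * V a a) := by
      rw [integral_mul_gaussianPair_self hφ hq]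
      positivity
    obtain ⟨hα, hβ⟩ :=
      (add_eq_zero_iff_of_nonneg (mul_nonneg α.coe_nonneg hint) β.coe_nonneg).1 hzero
    simp only [inputCov_activation, hβ, add_zero]
    rcases mul_eq_zero.1 hα with hα | hφ0
    · simp [hα]
    · refine tendsto_of_tendsto_of_tendsto_of_le_of_le tendsto_const_nhds
        (hV.tendsto_measure_exists_activation_ne_zero h hγ hN hr hp hind
          (ae_eq_zero_of_integral_mul_gaussianPair_self_eq_zero hφ hφL hq hφ0))
        (fun _ => zero_le) fun n => measure_mono fun ω hω => ?_
      by_contra hcon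
      simp only [Set.mem_ofPred_eq, not_exists, not_not] at hω hcon
      exact hω (by simp [hcon])

end HasLimitCov

end ActivationLimit

section Network

variable {d : ℕ} {φ : ℝ → ℝ}

namespace LowRankNetwork

variable {N r : ℕ → ℕ}

theorem preactivation_eq_layerMap (θ : LowRankNetwork d N r) (x : Fin d → ℝ) (l : ℕ) :
    θ.preactivation φ x l = layerMap (θ.C l) (θ.A l) (θ.b l) (θ.output φ x l, 1) := by
  simp only [preactivation, weight, bias, layerMap, one_smul, Matrix.mulVec_add,
    Matrix.mulVec_mulVec]

theorem output_succ (θ : LowRankNetwork d N r) (x : Fin d → ℝ) (l : ℕ) :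
    θ.output φ x (l + 1) =
      fun i => φ (layerMap (θ.C l) (θ.A l) (θ.b l) (θ.output φ x l, 1) i) := by
  simp only [← preactivation_eq_layerMap]
  rfl

theorem overlap_eq_average (θ : LowRankNetwork d N r) (x y : Fin d → ℝ) (l : ℕ) :
    θ.overlap φ x y l = (N (l + 1) : ℝ)⁻¹ • ∑ i,
      layerMap (θ.C l) (θ.A l) (θ.b l) (θ.output φ x l, 1) i *
        layerMap (θ.C l) (θ.A l) (θ.b l) (θ.output φ y l, 1) i := by
  rw [overlap, smul_eq_mul, div_eq_inv_mul, preactivation_eq_layerMap, preactivation_eq_layerMap]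

theorem measurable_output {Ω : Type*} [MeasurableSpace Ω] (hφ : Measurable φ)
    {θ : Ω → LowRankNetwork d N r} (x : Fin d → ℝ) (l : ℕ)
    (hθ : ∀ j < l, Measurable fun ω => ((θ ω).C j, (θ ω).A j, (θ ω).b j)) :
    Measurable fun ω => (θ ω).output φ x l := by
  induction l with
  | zero => exact measurable_const
  | succ l ih =>
    have hinput : Measurable fun ω => ((θ ω).output φ x l, (1 : ℝ)) :=
      (ih fun j hj => hθ j (hj.trans l.lt_succ_self)).prodMk measurable_const
    have hlast := hθ l l.lt_succ_self
    simp only [output_succ]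
    exact measurable_pi_lambda _ fun i => hφ.comp <| (measurable_pi_apply i).comp <|
      measurable_layerMap.comp ((hinput.prodMk (measurable_fst.comp hlast)).prodMk
        (measurable_snd.comp hlast))

end LowRankNetwork

namespace IsLowRankInit

variable {Ω : Type*} [MeasurableSpace Ω] {P : Measure Ω} {L : ℕ} {σα σb : ℝ} {N r : ℕ → ℕ}
  {θ : Ω → LowRankNetwork d N r} {l : ℕ}

theorem measurable_layer (h : IsLowRankInit P L σα σb θ) (hl : l < L) :
    Measurable fun ω => ((θ ω).C l, (θ ω).A l, (θ ω).b l) :=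
  (h.measurable_C l hl).prodMk ((h.measurable_A l hl).prodMk (h.measurable_b l hl))

theorem isRandomLowRankLayer (h : IsLowRankInit P L σα σb θ) (hl : l < L) :
    IsRandomLowRankLayer P (σα ^ 2 / (layerWidth d N l : ℝ)).toNNReal (σb ^ 2).toNNReal
      (fun ω => (θ ω).C l) (fun ω => (θ ω).A l) (fun ω => (θ ω).b l) where
  measurable_C := h.measurable_C l hl
  measurable_A := h.measurable_A l hl
  measurable_b := h.measurable_b l hl
  law_C := h.law_C l hl
  law_A := h.law_A l hl
  law_b := h.law_b l hl
  indep_entries_A := h.indep_entries_A l hl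
  indep_entries_b := h.indep_entries_b l hl
  indep_A_b := h.indep_A_b l hl
  indep_C_Ab := h.indep_C_Ab l hl

variable {κ : Type*}

theorem measurable_outputs (h : IsLowRankInit P L σα σb θ) (hφ : Measurable φ)
    (x : κ → Fin d → ℝ) (hl : l < L) :
    Measurable fun ω a => ((θ ω).output φ (x a) l, (1 : ℝ)) :=
  measurable_pi_lambda _ fun a => (LowRankNetwork.measurable_output hφ (x a) l
    fun _ hj => h.measurable_layer (hj.trans hl)).prodMk measurable_const

theorem indepFun_outputs (h : IsLowRankInit P L σα σb θ) (hφ : Measurable φ)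
    (x : κ → Fin d → ℝ) (hl : l < L) :
    IndepFun (fun ω a => ((θ ω).output φ (x a) l, (1 : ℝ)))
      (fun ω => ((θ ω).C l, (θ ω).A l, (θ ω).b l)) P := by
  set previous : Finset (Fin L) := {j | (j : ℕ) < l} with hprevious
  have hind := h.indep_layers.indepFun_finset previous {⟨l, hl⟩} (by simp [hprevious])
    fun j => h.measurable_layer j.2
  have hlayer : IndepFun (fun ω (j : previous) => ((θ ω).C j, (θ ω).A j, (θ ω).b j))
      (fun ω => ((θ ω).C l, (θ ω).A l, (θ ω).b l)) P :=
    hind.comp measurable_id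
      (measurable_pi_apply (⟨⟨l, hl⟩, by simp⟩ : ({⟨l, hl⟩} : Finset (Fin L))))
  refine indep_of_indep_of_le_left hlayer (Measurable.comap_le ?_)
  -- The outputs are measurable for the sigma-algebra generated by the previous layers.
  refine @measurable_pi_lambda _ _ _ (_) _ _ fun a => ?_
  refine @Measurable.prodMk _ _ _ _ _ (_) _ _ ?_ (@measurable_const _ _ _ (_) _)
  exact @LowRankNetwork.measurable_output d φ N r Ω (_) hφ θ (x a) l fun j hj =>
    (measurable_pi_apply (⟨⟨j, hj.trans hl⟩, by simpa [hprevious] using hj⟩ : previous)).comp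
      (comap_measurable fun ω (j : previous) => ((θ ω).C j, (θ ω).A j, (θ ω).b j))

end IsLowRankInit

end Network

section NetworkLimit

variable {κ : Type*} {d : ℕ} {φ : ℝ → ℝ} {γ : ℕ → ℝ} {σα σb : ℝ} {x : κ → Fin d → ℝ}

/-- The limits of the input covariances `σα² z⁽ˡ⁾ᵃ·z⁽ˡ⁾ᵇ / N + σb²` of the layers `l + 1` of a wide
low-rank network. The limits `qˡ⁺¹` of the preactivation covariances are `γ (l + 1)` times these. -/
noncomputable def limitCov (φ : ℝ → ℝ) (γ : ℕ → ℝ) (σα σb : ℝ) (x : κ → Fin d → ℝ) :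
    ℕ → κ → κ → ℝ
  | 0 => fun a b => σα ^ 2 * ((∑ i, x a i * x b i) / d) + σb ^ 2
  | l + 1 => fun a b =>
    let q := fun a b => γ (l + 1) * limitCov φ γ σα σb x l a b
    σα ^ 2 * (∫ y, φ y.1 * φ y.2 ∂gaussianPair (q a a) (q a b) (q b b)) + σb ^ 2

theorem limitCov_zero_eq_inputCov :
    limitCov φ γ σα σb x 0 = fun a b =>
      inputCov (σα ^ 2 / (d : ℝ)).toNNReal (σb ^ 2).toNNReal (x a, 1) (x b, 1) := by
  ext a b
  simp only [inputCov, limitCov, dotProduct, Real.coe_toNNReal _ (sq_nonneg σb),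
    Real.coe_toNNReal _ (div_nonneg (sq_nonneg σα) d.cast_nonneg)]
  ring

theorem mul_limitCov_succ_self (hφ : Measurable φ) {l : ℕ} {a : κ}
    (h : 0 ≤ γ (l + 1) * limitCov φ γ σα σb x l a a) (c : ℝ) :
    c * limitCov φ γ σα σb x (l + 1) a a =
      lengthMap φ c σα σb (γ (l + 1) * limitCov φ γ σα σb x l a a) := by
  simp only [limitCov, lengthMap, integral_mul_gaussianPair_self hφ h]

theorem mul_limitCov_succ (hφ : Measurable φ) (l : ℕ) (a b : κ) (c : ℝ) :
    c * limitCov φ γ σα σb x (l + 1) a b =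
      covMap φ c σα σb (γ (l + 1) * limitCov φ γ σα σb x l a b)
        (γ (l + 1) * limitCov φ γ σα σb x l a a) (γ (l + 1) * limitCov φ γ σα σb x l b b) := by
  simp only [limitCov, covMap, integral_mul_gaussianPair hφ hφ]

variable {Ω ι : Type*} [MeasurableSpace Ω] {P : Measure Ω} [IsProbabilityMeasure P]
  {f : Filter ι} [f.NeBot] [f.IsCountablyGenerated] {L : ℕ} {N r : ι → ℕ → ℕ}
  {θ : ∀ n, Ω → LowRankNetwork d (N n) (r n)}

theorem hasLimitCov_output (hφ : Measurable φ) (hφL : ∀ v, MemLp φ 2 (gaussianReal 0 v))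
    (hγ : ∀ l < L, 0 < γ (l + 1)) (hN : ∀ l < L, Tendsto (fun n => N n (l + 1)) f atTop)
    (hr : ∀ l < L, Tendsto (fun n => (r n (l + 1) : ℝ) / N n (l + 1)) f (𝓝 (γ (l + 1))))
    (hθ : ∀ n, IsLowRankInit P L σα σb (θ n)) {l : ℕ} (hl : l < L) :
    HasLimitCov P f (fun n => (σα ^ 2 / (layerWidth d (N n) l : ℝ)).toNNReal)
      (fun _ => (σb ^ 2).toNNReal) (fun n ω a => ((θ n ω).output φ (x a) l, 1))
      (limitCov φ γ σα σb x l) := by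
  induction l with
  | zero =>
    rw [limitCov_zero_eq_inputCov]
    exact hasLimitCov_const (σα ^ 2 / (d : ℝ)).toNNReal (σb ^ 2).toNNReal fun a => (x a, (1 : ℝ))
  | succ l ih =>
    have hl' : l < L := l.lt_succ_self.trans hl
    have hstep := (ih hl').activation (fun n => (hθ n).isRandomLowRankLayer hl') (hγ l hl')
      (hN l hl') (hr l hl') (fun n => (hθ n).measurable_outputs hφ x hl')
      (fun n => (hθ n).indepFun_outputs hφ x hl') hφ hφL (σα ^ 2).toNNReal (σb ^ 2).toNNReal
    simp only [Real.coe_toNNReal _ (sq_nonneg _)] at hstep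
    simpa only [LowRankNetwork.output_succ, layerWidth, limitCov, Real.toNNReal_div (sq_nonneg σα),
      Real.toNNReal_natCast] using hstep

theorem tendstoInMeasure_overlap (hφ : Measurable φ) (hφL : ∀ v, MemLp φ 2 (gaussianReal 0 v))
    (hγ : ∀ l < L, 0 < γ (l + 1)) (hN : ∀ l < L, Tendsto (fun n => N n (l + 1)) f atTop)
    (hr : ∀ l < L, Tendsto (fun n => (r n (l + 1) : ℝ) / N n (l + 1)) f (𝓝 (γ (l + 1))))
    (hθ : ∀ n, IsLowRankInit P L σα σb (θ n)) {l : ℕ} (hl : l < L) (a b : κ) :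
    TendstoInMeasure P (fun n ω => (θ n ω).overlap φ (x a) (x b) l) f
      fun _ => γ (l + 1) * limitCov φ γ σα σb x l a b := by
  have hV := hasLimitCov_output (x := x) hφ hφL hγ hN hr hθ hl
  have hid := fun v => IsGaussian.memLp_id (gaussianReal 0 v) 2 ENNReal.ofNat_ne_top
  rw [← integral_fst_mul_snd_gaussianPair (hV.covForm_const_mul_nonneg (hγ l hl).le a b)]
  simp only [LowRankNetwork.overlap_eq_average]
  exact hV.tendstoInMeasure_average_mul_layerMap
    (fun n => (hθ n).isRandomLowRankLayer hl) (hγ l hl) (hN l hl) (hr l hl)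
    (fun n => (hθ n).measurable_outputs hφ x hl) (fun n => (hθ n).indepFun_outputs hφ x hl)
    measurable_id measurable_id hid hid a b

end NetworkLimit

theorem lengthMap_eq_pooleLengthMap (φ : ℝ → ℝ) (γ σα σb q : ℝ) :
    lengthMap φ γ σα σb q = pooleLengthMap φ (γ * σα ^ 2) (γ * σb ^ 2) q := by
  rw [lengthMap, pooleLengthMap]
  ring

theorem covMap_eq_pooleCovMap (φ : ℝ → ℝ) (γ σα σb q₁₂ q₁₁ q₂₂ : ℝ) :
    covMap φ γ σα σb q₁₂ q₁₁ q₂₂ = pooleCovMap φ (γ * σα ^ 2) (γ * σb ^ 2) q₁₂ q₁₁ q₂₂ := by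
  rw [covMap, pooleCovMap]
  ring

theorem mainTheorem1
    {Ω : Type*} [MeasurableSpace Ω] (P : Measure Ω) [IsProbabilityMeasure P]
    -- depth, input dimension, two inputs
    (L d : ℕ) (hd : 0 < d) (x : Fin 2 → Fin d → ℝ)
    -- activation function, for which the Gaussian integrals are finite
    (φ : ℝ → ℝ) (hφ : Measurable φ)
    (hφ2 : ∀ s : ℝ, Integrable (fun z => φ (s * z) ^ 2) stdGaussian1)
    (σα σb : ℝ)
    -- widths and ranks of a sequence of networks, rank-to-width ratios
    (N r : ℕ → ℕ → ℕ) (γ : ℕ → ℝ)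
    (hγ : ∀ l, 1 ≤ l → l ≤ L → 0 < γ l ∧ γ l ≤ 1)
    (hN : ∀ l, 1 ≤ l → l ≤ L → Tendsto (fun n => N n l) atTop atTop)
    (hr : ∀ l, 1 ≤ l → l ≤ L → Tendsto (fun n => (r n l : ℝ) / (N n l : ℝ)) atTop (𝓝 (γ l)))
    -- the random networks
    (θ : (n : ℕ) → Ω → LowRankNetwork d (N n) (r n))
    (hθ : ∀ n, IsLowRankInit P L σα σb (θ n)) :
    ∃ q : ℕ → Fin 2 → Fin 2 → ℝ,
      -- lengths and covariances of layers `1, …, L` converge in probability to `q`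
      (∀ l < L, ∀ a b, TendstoInMeasure P (fun n ω => (θ n ω).overlap φ (x a) (x b) l) atTop
        (fun _ => q (l + 1) a b)) ∧
      -- first layer, fed with the input itself
      (∀ a b, 1 ≤ L → q 1 a b = γ 1 * (σα ^ 2 * ((∑ i, x a i * x b i) / (d : ℝ)) + σb ^ 2)) ∧
      -- recursion from layer `l` to layer `l + 1`
      (∀ l, 1 ≤ l → l < L →
        (∀ a, 0 ≤ q l a a ∧
          q (l + 1) a a = lengthMap φ (γ (l + 1)) σα σb (q l a a) ∧
          q (l + 1) a a =
            pooleLengthMap φ (γ (l + 1) * σα ^ 2) (γ (l + 1) * σb ^ 2) (q l a a)) ∧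
        (|corr (q l 0 1) (q l 0 0) (q l 1 1)| ≤ 1 ∧
          Integrable (fun z => φ (gaussU₁ (q l 0 0) z) *
            φ (gaussU₂ (q l 1 1) (corr (q l 0 1) (q l 0 0) (q l 1 1)) z))
            (stdGaussian1.prod stdGaussian1) ∧
          q (l + 1) 0 1 = covMap φ (γ (l + 1)) σα σb (q l 0 1) (q l 0 0) (q l 1 1) ∧
          q (l + 1) 0 1 =
            pooleCovMap φ (γ (l + 1) * σα ^ 2) (γ (l + 1) * σb ^ 2)
              (q l 0 1) (q l 0 0) (q l 1 1))) := by
  have hφL := memLp_two_gaussianReal_of_integrable_sq hφ hφ2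
  have hγ' : ∀ l < L, 0 < γ (l + 1) := fun l hl => (hγ (l + 1) (by omega) hl).1
  have hN' := fun l (hl : l < L) => hN (l + 1) (by omega) hl
  have hr' := fun l (hl : l < L) => hr (l + 1) (by omega) hl
  refine ⟨fun l a b => γ l * limitCov φ γ σα σb x (l - 1) a b,
    fun l hl a b => tendstoInMeasure_overlap hφ hφL hγ' hN' hr' hθ hl a b, fun a b _ => rfl,
    fun l hl hlL => ?_⟩
  obtain ⟨k, rfl⟩ := Nat.exists_eq_add_of_le' hl
  have hk : k < L := k.lt_succ_self.trans hlL
  have hq := (hasLimitCov_output (x := x) hφ hφL hγ' hN' hr' hθ hk).covForm_const_mul_nonneg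
    (hγ' k hk).le
  have hlength := fun a => nonneg_left_of_covForm_nonneg (hq a a)
  have hcov := mul_limitCov_succ (γ := γ) (σα := σα) (σb := σb) (x := x) hφ k 0 1 (γ (k + 1 + 1))
  exact ⟨fun a => ⟨hlength a, mul_limitCov_succ_self hφ (hlength a) _,
      (mul_limitCov_succ_self hφ (hlength a) _).trans (lengthMap_eq_pooleLengthMap ..)⟩,
    abs_corr_le_one (sq_le_mul_of_covForm_nonneg (hq 0 1)), integrable_mul_gaussU hφ hφL (hq 0 1),
    hcov, hcov.trans (covMap_eq_pooleCovMap ..)⟩
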